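/- Let $b$ be a bounded, continuously differentiable function on $\mathbb{R}\times[0,\infty)$, let $1\le p_0<\infty$, and let $u_0\in L^{p_0}(\mathbb{R})\cap L^\infty(\mathbb{R})$. Let $u:\mathbb{R}\times[0,\infty)\to\mathbb{R}$ be a solution of $$u_t+(b(x,t)\,u)_x=u_{xx}\quad (x\in\mathbb{R},\ t>0),\qquad u(\cdot,0)=u_0,$$ that is: $u$ is bounded on $\mathbb{R}\times[0,T]$ for every $T>0$; on $\mathbb{R}\times(0,\infty)$ it is $C^2$ in $x$ and $C^1$ in $t$ (with $u,u_t,u_x,u_{xx}$ continuous there) and satisfies the equation pointwise; $u(\cdot,0)=u_0$ almost everywhere; and $\int_K|u(x,t)-u_0(x)|\,dx\to0$ as $t\to0^+$ for every compact $K\subset\mathbb{R}$. Put $$B(t)=\tfrac12\Bigl(\sup_{x\in\mathbb{R}}b(x,t)-\inf_{x\in\mathbb{R}}b(x,t)\Bigr),\qquad \mathcal{B}=\limsup_{t\to\infty}B(t).$$ 1. For every real $p\ge p_0$, $$\limsup_{t\to\infty}\|u(\cdot,t)\|_{L^\infty(\mathbb{R})}\le K(p)\cdot\mathcal{B}^{1/p}\cdot\limsup_{t\to\infty}\|u(\cdot,t)\|_{L^p(\mathbb{R})},\qquad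 K(p)=\Bigl(\frac{3\sqrt3}{2\pi}\,p\Bigr)^{1/p},$$ where the right-hand side is read with the convention $0\cdot\infty=\infty$. Moreover, with $C_2=\bigl(\frac{3\sqrt3}{4\pi}\bigr)^{1/3}$, $$K(p)=\Bigl[\prod_{j=1}^{\infty}\bigl(2^{j-1}p\,C_2^3\bigr)^{2^{-j}}\Bigr]^{1/p}.$$ 2. If $p_0=1$, then $$\limsup_{t\to\infty}\|u(\cdot,t)\|_{L^\infty(\mathbb{R})}\le\frac{3\sqrt3}{2\pi}\,\mathcal{B}\,\|u_0\|_{L^1(\mathbb{R})},$$ and $u$ is bounded on $\mathbb{R}\times[0,\infty)$. -/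

import Mathlib

open MeasureTheory Filter Topology Set
open scoped ENNReal

/-- A bounded, continuously differentiable advection field on `ℝ × [0, ∞)`;
`b x t` is the value at position `x` and time `t`. -/
structure IsAdvectionField (b : ℝ → ℝ → ℝ) : Prop where
  contDiffOn : ContDiffOn ℝ 1 (Function.uncurry b) (univ ×ˢ Ici (0 : ℝ))
  bounded : ∃ C : ℝ, ∀ x t : ℝ, 0 ≤ t → |b x t| ≤ C

/-- `u` is a (global) solution of `u_t + (b u)_x = u_xx` on `ℝ × (0, ∞)` with initial value `u₀`:
it is bounded on every strip `ℝ × [0, T]`, it is `C²` in `x` and `C¹` in `t` for `t > 0` (the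
derivatives `u_t`, `u_x`, `u_xx` being continuous on `ℝ × (0, ∞)`), it satisfies the equation
pointwise there, and `u(·, t) → u₀` in `L¹` on every compact set as `t → 0`. -/
structure IsSolution (b : ℝ → ℝ → ℝ) (u₀ : ℝ → ℝ) (u : ℝ → ℝ → ℝ) : Prop where
  bounded_strip : ∀ T : ℝ, 0 < T → ∃ M : ℝ, ∀ x t : ℝ, 0 ≤ t → t ≤ T → |u x t| ≤ M
  contDiff_space : ∀ t : ℝ, 0 < t → ContDiff ℝ 2 (fun x => u x t)
  contDiffOn_time : ∀ x : ℝ, ContDiffOn ℝ 1 (fun t => u x t) (Ioi 0)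
  continuousOn : ContinuousOn (fun z : ℝ × ℝ => u z.1 z.2) (univ ×ˢ Ioi (0 : ℝ))
  continuousOn_dt :
    ContinuousOn (fun z : ℝ × ℝ => deriv (fun s => u z.1 s) z.2) (univ ×ˢ Ioi (0 : ℝ))
  continuousOn_dx :
    ContinuousOn (fun z : ℝ × ℝ => deriv (fun y => u y z.2) z.1) (univ ×ˢ Ioi (0 : ℝ))
  continuousOn_dxx :
    ContinuousOn (fun z : ℝ × ℝ => iteratedDeriv 2 (fun y => u y z.2) z.1) (univ ×ˢ Ioi (0 : ℝ))
  equation : ∀ x t : ℝ, 0 < t →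
    deriv (fun s => u x s) t + deriv (fun y => b y t * u y t) x
      = iteratedDeriv 2 (fun y => u y t) x
  initial_eq : (fun x => u x 0) =ᵐ[volume] u₀
  initial_lim : ∀ K : Set ℝ, IsCompact K →
    Tendsto (fun t : ℝ => ∫⁻ x in K, ‖u x t - u₀ x‖ₑ) (𝓝[>] 0) (𝓝 0)

/-- `B(t)`: half the oscillation of `b(·, t)`. -/
noncomputable def halfOsc (b : ℝ → ℝ → ℝ) (t : ℝ) : ℝ :=
  (1 / 2) * ((⨆ x : ℝ, b x t) - ⨅ x : ℝ, b x t)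

/-- `𝓑 = limsup_{t → ∞} B(t)`. -/
noncomputable def limHalfOsc (b : ℝ → ℝ → ℝ) : ℝ :=
  limsup (fun t : ℝ => halfOsc b t) atTop

/-- `limsup_{t → ∞} ‖u(·, t)‖_{L^q(ℝ)}`, a value in `[0, ∞]`. -/
noncomputable def limNorm (u : ℝ → ℝ → ℝ) (q : ℝ≥0∞) : ℝ≥0∞ :=
  limsup (fun t : ℝ => eLpNorm (fun x => u x t) q volume) atTop

/-- Multiplication on `[0, ∞]` with the convention `0 · ∞ = ∞`
(Mathlib's own multiplication has `0 * ∞ = 0`). -/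
noncomputable def mulTop (a c : ℝ≥0∞) : ℝ≥0∞ :=
  open Classical in if a = ⊤ ∨ c = ⊤ then ⊤ else a * c

/-- `C₂ = (3√3 / (4π))^{1/3}`. -/
noncomputable def nashConst : ℝ := (3 * √3 / (4 * Real.pi)) ^ (1 / 3 : ℝ)

/-!
The proof is an iteration over the norms `L^{2^j p}`, followed by a passage to `L^∞`.

*Doubling the exponent.* After subtracting from `b(·, t)` the midrange of its values, which leaves a
function bounded by `B(t)`, one finds that the quantity `F = ∫ |u|^q` with `q = 2r ≥ 2` satisfies
`F' ≤ q (q - 1) (-D + B √D √F)`, `D = ∫ |u|^{q-2} u_x²`. The sharp Nash inequality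
(`nash_inequality`), applied to `|u|^{r-1} u`, bounds `D` from below in terms of `F` and of
`∫ |u|^r`. Hence, once `∫ |u|^r ≤ N`, the integral `F` decreases at a uniform rate as long as it
exceeds a given number above `r C N² B`, with `C = 3√3 / (4π)`, and eventually lies below that number
(`IsSolution.eventually_lintegral_two_mul_le`). Solving the recursion, `∫ |u|^{2^j p}` is
eventually below `(2 X N)^{2^j} / (2^j X)`, where `X = p C B` and `N` bounds `∫ |u|^p`; its
`2^j`-th root tends to `2 X N = (3√3 / (2π)) p B N`, which is where `K(p)` comes from.

*Passage to the supremum.* Testing the equation with a backward heat kernel gives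
`‖u(t + h)‖_∞ ≤ A + A h^{-1/2} ∫ |u(t)|^q / A^q + O(√h) sup |u|` for every `A > 0`
(`IsSolution.abs_le_of_lintegral_le`). With `q = p` and `h` small it shows that `u` is bounded;
with `q = 2^j p` and `A^p ≥ 2 X N`, letting `j → ∞` and then `h → 0`, it leaves
`limsup ‖u‖_∞ ≤ A`.

*The case `p₀ = 1`.* The `L¹` norm does not exceed its initial value
(`IsSolution.lintegral_abs_le`), so the first part applies with `p = 1`.

No decay of `u_x` and no bound on `b_x` is available. All integrations by parts are therefore
done on bounded intervals, with polynomial weights such as `(1 - x² / R²)²` that vanish to second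
order at the ends, and with every derivative moved off `u` except in the dissipation and the
advection term (`IsSolution.hasDerivAt_integral_mul_weight`).
-/

/-! ### Elementary inequalities -/

/-- The Cauchy–Schwarz inequality for continuous functions on an interval. -/
theorem sq_integral_mul_le {f g : ℝ → ℝ} (hf : Continuous f) (hg : Continuous g) {a b : ℝ}
    (hab : a ≤ b) :
    (∫ x in a..b, f x * g x) ^ 2 ≤ (∫ x in a..b, f x ^ 2) * ∫ x in a..b, g x ^ 2 := by
  have key : ∀ l : ℝ, 0 ≤ (∫ x in a..b, f x ^ 2) * (l * l) + (2 * ∫ x in a..b, f x * g x) * l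
      + ∫ x in a..b, g x ^ 2 := by
    intro l
    have h : (∫ x in a..b, (l * f x + g x) ^ 2)
        = (∫ x in a..b, f x ^ 2) * (l * l) + (2 * ∫ x in a..b, f x * g x) * l
          + ∫ x in a..b, g x ^ 2 := by
      rw [← intervalIntegral.integral_mul_const, ← intervalIntegral.integral_const_mul,
        ← intervalIntegral.integral_mul_const, ← intervalIntegral.integral_add,
        ← intervalIntegral.integral_add]
      · exact intervalIntegral.integral_congr fun x _ => by ring
      all_goals exact Continuous.intervalIntegrable (by fun_prop) _ _
    rw [← h]
    exact intervalIntegral.integral_nonneg hab fun x _ => sq_nonneg _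
  have := discrim_le_zero key
  rw [discrim] at this
  nlinarith

theorem hasDerivAt_abs_rpow_mul_self {s : ℝ} (hs : 0 ≤ s) (v : ℝ) :
    HasDerivAt (fun v : ℝ => |v| ^ s * v) ((s + 1) * |v| ^ s) v := by
  rcases hs.eq_or_lt with rfl | hs
  · simpa using hasDerivAt_id' v
  rcases eq_or_ne v 0 with rfl | hv
  · rw [hasDerivAt_iff_tendsto_slope]
    have h : Tendsto (fun v : ℝ => |v| ^ s) (𝓝[≠] 0) (𝓝 ((s + 1) * |(0 : ℝ)| ^ s)) := by
      have : Continuous fun v : ℝ => |v| ^ s := continuous_abs.rpow_const fun _ => Or.inr hs.le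
      have h2 := this.tendsto 0
      simp only [abs_zero, Real.zero_rpow hs.ne', mul_zero] at h2 ⊢
      exact h2.mono_left nhdsWithin_le_nhds
    refine h.congr' ?_
    filter_upwards [self_mem_nhdsWithin] with y hy
    have hy : y ≠ 0 := hy
    simp [slope_def_field, hy]
  · have h1 : HasDerivAt (fun v : ℝ => |v| ^ (s + 2)) ((s + 2) * |v| ^ (s + 2 - 2) * v) v :=
      hasDerivAt_abs_rpow v (by linarith)
    have h2 := h1.div (hasDerivAt_id v) hv
    have e : ∀ w : ℝ, w ≠ 0 → |w| ^ (s + 2) = |w| ^ s * w ^ 2 := fun w hw => by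
      rw [Real.rpow_add (abs_pos.2 hw), Real.rpow_two, sq_abs]
    have h3 : (fun w : ℝ => |w| ^ s * w) =ᶠ[𝓝 v] fun w => |w| ^ (s + 2) / id w := by
      filter_upwards [isOpen_ne.mem_nhds hv] with w hw
      have hw : w ≠ 0 := hw
      rw [e w hw, id]
      field_simp
    refine (h2.congr_of_eventuallyEq h3).congr_deriv ?_
    rw [e v hv, id, add_sub_cancel_right]
    field_simp
    ring

theorem continuous_abs_rpow {s : ℝ} (hs : 0 ≤ s) : Continuous fun v : ℝ => |v| ^ s :=
  continuous_abs.rpow_const fun _ => Or.inr hs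

/-- The area of a half disc of diameter `m`. -/
theorem integral_sqrt_mul_sub_sq {m : ℝ} (hm : 0 < m) :
    ∫ s in (0 : ℝ)..m, √(m * |s| - s ^ 2) = Real.pi * m ^ 2 / 8 := by
  have h := intervalIntegral.integral_comp_mul_add (a := -1) (b := 1)
    (fun s : ℝ => √(m * |s| - s ^ 2)) (c := m / 2) (by positivity) (m / 2)
  have e0 : m / 2 * -1 + m / 2 = 0 := by ring
  have e1 : m / 2 * 1 + m / 2 = m := by ring
  rw [e0, e1] at h
  have h2 : (∫ x in (-1 : ℝ)..1, √(m * |m / 2 * x + m / 2| - (m / 2 * x + m / 2) ^ 2))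
      = ∫ x in (-1 : ℝ)..1, m / 2 * √(1 - x ^ 2) := by
    refine intervalIntegral.integral_congr fun x hx => ?_
    rw [uIcc_of_le (by norm_num)] at hx
    have hnn : 0 ≤ m / 2 * x + m / 2 := by nlinarith [hx.1]
    have : m * |m / 2 * x + m / 2| - (m / 2 * x + m / 2) ^ 2 = (m / 2) ^ 2 * (1 - x ^ 2) := by
      rw [abs_of_nonneg hnn]; ring
    simp only [this]
    rw [Real.sqrt_mul (sq_nonneg _), Real.sqrt_sq (by positivity)]
  rw [h2, intervalIntegral.integral_const_mul, integral_sqrt_one_sub_sq] at h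
  rw [smul_eq_mul] at h
  field_simp at h ⊢
  linarith

/-- `S³ (X - S)` is largest at `S = 3X / 4`. -/
theorem cube_mul_sub_le (S X : ℝ) : 256 * (S ^ 3 * (X - S)) ≤ 27 * X ^ 4 := by
  nlinarith [mul_nonneg (sq_nonneg (4 * S - 3 * X))
    (by nlinarith [sq_nonneg (4 * S + X), sq_nonneg X] :
      (0 : ℝ) ≤ 16 * S ^ 2 + 8 * S * X + 3 * X ^ 2)]

/-- **Nash's inequality** on the line with its sharp constant, for functions vanishing at the
ends of an interval. With `m = max |g|`, the function `√(m |g| - g²)` is the profile of `|g'|` for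
the extremal functions `1 + cos`; comparing `∫ |g'| √(m |g| - g²)` with the area swept out on the
way from `0` to `m` and back gives the bound. -/
theorem nash_inequality {g g' : ℝ → ℝ} (hg : ∀ x, HasDerivAt g (g' x) x) (hg' : Continuous g')
    {a b : ℝ} (hab : a ≤ b) (ha : g a = 0) (hb : g b = 0) :
    16 * Real.pi ^ 2 * (∫ x in a..b, g x ^ 2) ^ 3
      ≤ 27 * (∫ x in a..b, |g x|) ^ 4 * ∫ x in a..b, g' x ^ 2 := by
  have hgc : Continuous g := continuous_iff_continuousAt.2 fun x => (hg x).continuousAt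
  obtain ⟨x₀, hx₀, hmax⟩ := isCompact_Icc.exists_isMaxOn (nonempty_Icc.2 hab)
    (hgc.abs.continuousOn (s := Icc a b))
  have hN : 0 ≤ ∫ x in a..b, |g x| := intervalIntegral.integral_nonneg hab fun x _ => abs_nonneg _
  have hD : 0 ≤ ∫ x in a..b, g' x ^ 2 := intervalIntegral.integral_nonneg hab fun x _ => sq_nonneg _
  set m := |g x₀| with hm
  have hle : ∀ x ∈ Icc a b, |g x| ≤ m := fun x hx => hmax hx
  rcases (abs_nonneg (g x₀)).eq_or_lt with h0 | hmpos
  · have : (∫ x in a..b, g x ^ 2) = 0 := by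
      rw [← intervalIntegral.integral_zero (a := a) (b := b) (μ := volume)]
      refine intervalIntegral.integral_congr fun x hx => ?_
      rw [uIcc_of_le hab] at hx
      have := (hle x hx).trans_eq (hm.trans h0.symm)
      simp [abs_nonpos_iff.1 this]
    rw [this]
    simp only [ne_eq, OfNat.ofNat_ne_zero, not_false_eq_true, zero_pow, mul_zero]
    positivity
  rw [← hm] at hmpos
  set h : ℝ → ℝ := fun s => √(m * |s| - s ^ 2) with hh
  have hc : Continuous h := by fun_prop
  -- `H` is odd, so `|H (g x₀)| = H m` whatever the sign of `g x₀`
  set H : ℝ → ℝ := fun s => ∫ y in (0 : ℝ)..s, h y with hH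
  have hHd : ∀ s, HasDerivAt H (h s) s := fun s =>
    intervalIntegral.integral_hasDerivAt_right (hc.intervalIntegrable _ _)
      hc.stronglyMeasurable.stronglyMeasurableAtFilter hc.continuousAt
  have hHm : |H (g x₀)| = Real.pi * m ^ 2 / 8 := by
    have hpos : H m = Real.pi * m ^ 2 / 8 := integral_sqrt_mul_sub_sq hmpos
    rcases abs_choice (g x₀) with e | e
    · rw [← e, ← hm, ← hpos, abs_of_nonneg]
      rw [hpos]; positivity
    · have e' : g x₀ = -m := by linarith
      have : H (-m) = -H m := by
        simp only [hH]
        rw [intervalIntegral.integral_symm]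
        have := intervalIntegral.integral_comp_neg (a := 0) (b := m) h
        rw [neg_zero] at this
        rw [← this]
        simp [hh]
      rw [e', this, abs_neg, ← hpos, abs_of_nonneg]
      rw [hpos]; positivity
  have hcomp : ∀ x, HasDerivAt (fun x => H (g x)) (h (g x) * g' x) x := fun x =>
    (hHd (g x)).comp x (hg x)
  have hcc : Continuous fun x => h (g x) * g' x := by fun_prop
  have hint : ∀ c d, ∫ x in c..d, h (g x) * g' x = H (g d) - H (g c) := fun c d =>
    intervalIntegral.integral_eq_sub_of_hasDerivAt (fun x _ => hcomp x) (hcc.intervalIntegrable _ _)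
  have hH0 : H 0 = 0 := by simp [hH]
  have hnn : ∀ s, 0 ≤ h s := fun s => Real.sqrt_nonneg _
  have habs : ∀ x, |h (g x) * g' x| = |g' x| * h (g x) := fun x => by
    rw [abs_mul, abs_of_nonneg (hnn _), mul_comm]
  have hle1 : Real.pi * m ^ 2 / 8 ≤ ∫ x in a..x₀, |g' x| * h (g x) := by
    have := intervalIntegral.abs_integral_le_integral_abs (f := fun x => h (g x) * g' x)
      (μ := volume) hx₀.1
    rw [hint, ha, hH0, sub_zero, hHm] at this
    simpa only [habs] using this
  have hle2 : Real.pi * m ^ 2 / 8 ≤ ∫ x in x₀..b, |g' x| * h (g x) := by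
    have := intervalIntegral.abs_integral_le_integral_abs (f := fun x => h (g x) * g' x)
      (μ := volume) hx₀.2
    rw [hint, hb, hH0, zero_sub, abs_neg, hHm] at this
    simpa only [habs] using this
  have hsum : Real.pi * m ^ 2 / 4 ≤ ∫ x in a..b, |g' x| * h (g x) := by
    rw [← intervalIntegral.integral_add_adjacent_intervals (b := x₀)]
    · linarith
    all_goals exact Continuous.intervalIntegrable (by fun_prop) _ _
  -- with `S`, `N`, `D` the integrals of `g²`, `|g|`, `g'²`: `(π m² / 4)² ≤ D (m N - S)`
  have hcs := sq_integral_mul_le (f := fun x => |g' x|) (g := fun x => h (g x))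
    (by fun_prop) (by fun_prop) hab
  have hS : (∫ x in a..b, h (g x) ^ 2) = m * (∫ x in a..b, |g x|) - ∫ x in a..b, g x ^ 2 := by
    rw [← intervalIntegral.integral_const_mul, ← intervalIntegral.integral_sub]
    · refine intervalIntegral.integral_congr fun x hx => ?_
      rw [uIcc_of_le hab] at hx
      simp only [hh]
      rw [Real.sq_sqrt]
      rw [← sq_abs (g x)]
      nlinarith [hle x hx, abs_nonneg (g x)]
    all_goals exact Continuous.intervalIntegrable (by fun_prop) _ _
  simp only [sq_abs] at hcs
  rw [hS] at hcs
  set N := ∫ x in a..b, |g x|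
  set S := ∫ x in a..b, g x ^ 2
  set D := ∫ x in a..b, g' x ^ 2
  have h1 : (Real.pi * m ^ 2 / 4) ^ 2 ≤ D * (m * N - S) :=
    (pow_le_pow_left₀ (by positivity) hsum 2).trans hcs
  have hpos : 0 < m * N - S := by
    by_contra hcon
    have : 0 < (Real.pi * m ^ 2 / 4) ^ 2 := by positivity
    nlinarith
  have h2 := cube_mul_sub_le S (m * N)
  have h3 : 27 * N ^ 4 * ((Real.pi * m ^ 2 / 4) ^ 2) ≤ 27 * N ^ 4 * (D * (m * N - S)) := by gcongr
  have h4 : Real.pi ^ 2 * (256 * (S ^ 3 * (m * N - S))) ≤ Real.pi ^ 2 * (27 * (m * N) ^ 4) := by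
    gcongr
  refine le_of_mul_le_mul_right ?_ hpos
  nlinarith

/-- A differentiable function that decreases at rate at least `κ` while it is `≥ l` ends up
below `l` once enough time has passed. -/
theorem le_of_deriv_le_neg_of_ge {F F' : ℝ → ℝ} {a b l κ : ℝ} (hκ : 0 < κ)
    (hab : a ≤ b) (hF : ∀ t ∈ Icc a b, HasDerivAt F (F' t) t)
    (hdec : ∀ t ∈ Icc a b, l ≤ F t → F' t ≤ -κ) (hlong : F a - κ * (b - a) ≤ l) : F b ≤ l := by
  by_cases hex : ∃ s ∈ Icc a b, F s ≤ l
  · obtain ⟨s, hs, hsl⟩ := hex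
    have hsub : Icc s b ⊆ Icc a b := Icc_subset_Icc_left hs.1
    refine image_le_of_deriv_right_lt_deriv_boundary' (f := F) (f' := F') (a := s) (b := b)
      (fun t ht => (hF t (hsub ht)).continuousAt.continuousWithinAt)
      (fun t ht => (hF t (hsub (Ico_subset_Icc_self ht))).hasDerivWithinAt)
      (B := fun _ => l) (B' := fun _ => 0) hsl continuousOn_const
      (fun t _ => hasDerivWithinAt_const _ _ _) (fun t ht h => ?_) (right_mem_Icc.2 hs.2)
    exact (hdec t (hsub (Ico_subset_Icc_self ht)) h.ge).trans_lt (by linarith)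
  · push Not at hex
    have h := (convex_Icc a b).image_sub_le_mul_sub_of_deriv_le (f := F) (C := -κ)
      (fun t ht => (hF t ht).continuousAt.continuousWithinAt)
      (fun t ht => (hF t (interior_subset ht)).differentiableAt.differentiableWithinAt)
      (fun t ht => by
        rw [(hF t (interior_subset ht)).deriv]
        exact hdec t (interior_subset ht) (hex t (interior_subset ht)).le)
      a (left_mem_Icc.2 hab) b (right_mem_Icc.2 hab) hab
    linarith

theorem sub_le_mul_sub_of_hasDerivAt_le {F F' : ℝ → ℝ} {a b κ : ℝ}
    (hab : a ≤ b) (hF : ∀ t ∈ Icc a b, HasDerivAt F (F' t) t)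
    (hdec : ∀ t ∈ Icc a b, F' t ≤ κ) : F b - F a ≤ κ * (b - a) :=
  (convex_Icc a b).image_sub_le_mul_sub_of_deriv_le (f := F) (C := κ)
    (fun t ht => (hF t ht).continuousAt.continuousWithinAt)
    (fun t ht => (hF t (interior_subset ht)).differentiableAt.differentiableWithinAt)
    (fun t ht => by
      rw [(hF t (interior_subset ht)).deriv]
      exact hdec t (interior_subset ht))
    a (left_mem_Icc.2 hab) b (right_mem_Icc.2 hab) hab

/-! ### Exhausting the line by the weights `(1 - x² / R²)²` -/

/-- Fatou's lemma along integer `R`. -/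
theorem lintegral_le_of_weighted_le {f : ℝ → ℝ} (hf : Continuous f) (hf0 : ∀ x, 0 ≤ f x) {l : ℝ}
    (h : ∀ᶠ R : ℝ in atTop, ∫ x in -R..R, f x * (1 - x ^ 2 / R ^ 2) ^ 2 ≤ l) :
    ∫⁻ x, ENNReal.ofReal (f x) ≤ ENNReal.ofReal l := by
  set F : ℕ → ℝ → ℝ≥0∞ := fun n => (Ioc (-(n : ℝ)) n).indicator
    fun x => ENNReal.ofReal (f x * (1 - x ^ 2 / (n : ℝ) ^ 2) ^ 2) with hF
  have hmeas : ∀ n, Measurable (F n) := fun n =>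
    (ENNReal.measurable_ofReal.comp (by fun_prop)).indicator measurableSet_Ioc
  have hlim : ∀ x, Tendsto (fun n => F n x) atTop (𝓝 (ENNReal.ofReal (f x))) := by
    intro x
    have h1 : Tendsto (fun n : ℕ => ENNReal.ofReal (f x * (1 - x ^ 2 / (n : ℝ) ^ 2) ^ 2)) atTop
        (𝓝 (ENNReal.ofReal (f x * (1 - 0) ^ 2))) := by
      refine (ENNReal.continuous_ofReal.tendsto _).comp ?_
      refine tendsto_const_nhds.mul ((tendsto_const_nhds.sub ?_).pow 2)
      exact tendsto_const_nhds.div_atTop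
        ((tendsto_pow_atTop two_ne_zero).comp tendsto_natCast_atTop_atTop)
    rw [sub_zero, one_pow, mul_one] at h1
    refine h1.congr' ?_
    filter_upwards [eventually_gt_atTop ⌈|x|⌉₊] with n hn
    have hx : |x| < n := Nat.lt_of_ceil_lt hn
    rw [abs_lt] at hx
    simp only [hF]
    rw [indicator_of_mem (mem_Ioc.2 ⟨hx.1, hx.2.le⟩)]
  calc ∫⁻ x, ENNReal.ofReal (f x) = ∫⁻ x, liminf (fun n => F n x) atTop :=
        lintegral_congr fun x => (hlim x).liminf_eq.symm
    _ ≤ liminf (fun n => ∫⁻ x, F n x) atTop := lintegral_liminf_le hmeas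
    _ ≤ ENNReal.ofReal l := by
        refine liminf_le_of_frequently_le' (Eventually.frequently ?_)
        filter_upwards [tendsto_natCast_atTop_atTop.eventually h] with n hn
        simp only [hF]
        rw [lintegral_indicator measurableSet_Ioc, ← ofReal_integral_eq_lintegral_ofReal]
        · refine ENNReal.ofReal_le_ofReal ?_
          rwa [← intervalIntegral.integral_of_le (by linarith [n.cast_nonneg (α := ℝ)])]
        · exact (Continuous.integrableOn_Icc (by fun_prop)).mono_set Ioc_subset_Icc_self
        · exact Eventually.of_forall fun x => mul_nonneg (hf0 x) (sq_nonneg _)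

theorem intervalIntegral_le_of_lintegral_le {f : ℝ → ℝ} (hf : Continuous f) (hf0 : ∀ x, 0 ≤ f x)
    {l : ℝ} (hl : 0 ≤ l) (h : ∫⁻ x, ENNReal.ofReal (f x) ≤ ENNReal.ofReal l) {a b : ℝ}
    (hab : a ≤ b) : ∫ x in a..b, f x ≤ l := by
  rw [← ENNReal.ofReal_le_ofReal_iff hl, intervalIntegral.integral_of_le hab,
    ofReal_integral_eq_lintegral_ofReal]
  · exact (setLIntegral_le_lintegral _ _).trans h
  · exact (hf.integrableOn_Icc).mono_set Ioc_subset_Icc_self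
  · exact Eventually.of_forall hf0

/-! ### Regularity of the field and of solutions -/

theorem IsAdvectionField.contDiff_space {b : ℝ → ℝ → ℝ} (hb : IsAdvectionField b) {t : ℝ}
    (ht : 0 ≤ t) : ContDiff ℝ 1 fun x => b x t := by
  have h : ContDiffOn ℝ 1 (fun x : ℝ => ((x, t) : ℝ × ℝ)) univ := by fun_prop
  have := hb.contDiffOn.comp h fun x _ => ⟨mem_univ _, ht⟩
  exact contDiffOn_univ.1 this

namespace IsSolution

variable {b : ℝ → ℝ → ℝ} {u₀ : ℝ → ℝ} {u : ℝ → ℝ → ℝ}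

theorem continuous_space (hu : IsSolution b u₀ u) {t : ℝ} (ht : 0 < t) :
    Continuous fun x => u x t := (hu.contDiff_space t ht).continuous

theorem hasDerivAt_space (hu : IsSolution b u₀ u) {t : ℝ} (ht : 0 < t) (x : ℝ) :
    HasDerivAt (fun y => u y t) (deriv (fun y => u y t) x) x :=
  ((hu.contDiff_space t ht).differentiable (by norm_num) x).hasDerivAt

theorem contDiff_deriv_space (hu : IsSolution b u₀ u) {t : ℝ} (ht : 0 < t) :
    ContDiff ℝ 1 (deriv fun y => u y t) := by
  have h : ContDiff ℝ (1 + 1) fun y => u y t := by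
    rw [one_add_one_eq_two]; exact hu.contDiff_space t ht
  exact (contDiff_succ_iff_deriv.1 h).2.2

theorem hasDerivAt_deriv_space (hu : IsSolution b u₀ u) {t : ℝ} (ht : 0 < t) (x : ℝ) :
    HasDerivAt (deriv fun y => u y t) (iteratedDeriv 2 (fun y => u y t) x) x := by
  have h := ((hu.contDiff_deriv_space ht).differentiable (by norm_num) x).hasDerivAt
  rwa [iteratedDeriv_succ, iteratedDeriv_one]

theorem hasDerivAt_time (hu : IsSolution b u₀ u) {t : ℝ} (ht : 0 < t) (x : ℝ) :
    HasDerivAt (fun s => u x s) (deriv (fun s => u x s) t) t :=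
  (((hu.contDiffOn_time x).differentiableOn (by norm_num)).differentiableAt
    (Ioi_mem_nhds ht)).hasDerivAt

end IsSolution

/-! ### Evolution of weighted integrals -/

theorem hasDerivAt_intervalIntegral_of_continuousOn {f f' : ℝ → ℝ → ℝ} {O : Set ℝ} (hO : IsOpen O)
    {s : ℝ} (hs : s ∈ O) (hf : ∀ t ∈ O, Continuous fun y => f y t)
    (hd : ∀ y, ∀ t ∈ O, HasDerivAt (fun t => f y t) (f' y t) t)
    (hf' : ContinuousOn (fun z : ℝ × ℝ => f' z.1 z.2) (univ ×ˢ O)) (α β : ℝ) :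
    HasDerivAt (fun t => ∫ y in α..β, f y t) (∫ y in α..β, f' y s) s := by
  obtain ⟨δ, hδ, hball⟩ := Metric.nhds_basis_closedBall.mem_iff.1 (hO.mem_nhds hs)
  obtain ⟨C, hC⟩ := (isCompact_uIcc (a := α) (b := β)).prod (isCompact_closedBall s δ)
    |>.exists_bound_of_continuousOn (hf'.mono (prod_mono (subset_univ _) hball))
  have hfs : Continuous fun y => f' y s := by
    rw [← continuousOn_univ]
    exact hf'.comp (f := fun y : ℝ => ((y, s) : ℝ × ℝ)) (by fun_prop) fun y _ => ⟨mem_univ _, hs⟩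
  refine (intervalIntegral.hasDerivAt_integral_of_dominated_loc_of_deriv_le
    (F := fun t y => f y t) (F' := fun t y => f' y t) (bound := fun _ => C)
    (s := Metric.closedBall s δ) (Metric.closedBall_mem_nhds s hδ) ?_ ?_ ?_ ?_ ?_ ?_).2
  · filter_upwards [hO.mem_nhds hs] with t ht
    exact (hf t ht).aestronglyMeasurable
  · exact (hf s hs).intervalIntegrable _ _
  · exact hfs.aestronglyMeasurable
  · exact Eventually.of_forall fun y hy t ht => hC (y, t) ⟨uIoc_subset_uIcc hy, ht⟩
  · exact intervalIntegrable_const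
  · exact Eventually.of_forall fun y _ t ht => hd y t (hball ht)

/-- The evolution of `∫ φ(u) ψ` for a weight `ψ` that vanishes together with `∂ψ/∂x` at the ends
of the interval: all derivatives of `u` are moved onto the weight, except for the dissipation
`φ''(u) u_x² ψ` and the advection term. The field `b(·, s)` may be replaced by `b(·, s) - c`
there, at the price of the term `c φ(u) ψ_x`. -/
theorem IsSolution.hasDerivAt_integral_mul_weight {b : ℝ → ℝ → ℝ} {u₀ : ℝ → ℝ} {u : ℝ → ℝ → ℝ}
    (hb : IsAdvectionField b) (hu : IsSolution b u₀ u) {φ φ' φ'' : ℝ → ℝ}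
    (hφ : ∀ v, HasDerivAt φ (φ' v) v) (hφ' : ∀ v, HasDerivAt φ' (φ'' v) v) (hφ'' : Continuous φ'')
    {O : Set ℝ} (hO : IsOpen O) (hO0 : O ⊆ Ioi 0) {ψ ψs : ℝ → ℝ → ℝ} {ψy ψyy : ℝ → ℝ}
    (hψ : ContinuousOn (fun z : ℝ × ℝ => ψ z.1 z.2) (univ ×ˢ O))
    (hψs : ContinuousOn (fun z : ℝ × ℝ => ψs z.1 z.2) (univ ×ˢ O))
    (hψd : ∀ y, ∀ t ∈ O, HasDerivAt (fun t => ψ y t) (ψs y t) t)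
    {s : ℝ} (hs : s ∈ O)
    (hψy : ∀ y, HasDerivAt (fun y => ψ y s) (ψy y) y) (hψyy : ∀ y, HasDerivAt ψy (ψyy y) y)
    (hψc : Continuous ψyy) {α β : ℝ} (h1 : ψ α s = 0) (h2 : ψ β s = 0) (h3 : ψy α = 0)
    (h4 : ψy β = 0) (c : ℝ) :
    HasDerivAt (fun t => ∫ y in α..β, φ (u y t) * ψ y t)
      (∫ y in α..β, (φ (u y s) * (ψs y s + ψyy y + c * ψy y)
        - φ'' (u y s) * deriv (fun y => u y s) y ^ 2 * ψ y s
        + (b y s - c) * u y s * (φ'' (u y s) * deriv (fun y => u y s) y * ψ y s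
            + φ' (u y s) * ψy y))) s := by
  have hs0 : 0 < s := hO0 hs
  have cφ : Continuous φ := continuous_iff_continuousAt.2 fun x => (hφ x).continuousAt
  have cφ' : Continuous φ' := continuous_iff_continuousAt.2 fun x => (hφ' x).continuousAt
  have cψ : ∀ t ∈ O, Continuous fun y => ψ y t := fun t ht => by
    rw [← continuousOn_univ]
    exact hψ.comp (f := fun y : ℝ => ((y, t) : ℝ × ℝ)) (by fun_prop) fun y _ => ⟨mem_univ _, ht⟩
  have cψs : Continuous fun y => ψs y s := by
    rw [← continuousOn_univ]
    exact hψs.comp (f := fun y : ℝ => ((y, s) : ℝ × ℝ)) (by fun_prop) fun y _ => ⟨mem_univ _, hs⟩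
  have cψy : Continuous ψy := continuous_iff_continuousAt.2 fun x => (hψyy x).continuousAt
  have cus := hu.continuous_space hs0
  have hbs := hb.contDiff_space hs0.le
  have cb := hbs.continuous
  have hbd : ∀ y, HasDerivAt (fun y => b y s) (deriv (fun y => b y s) y) y := fun y =>
    (hbs.differentiable (by norm_num) y).hasDerivAt
  have cb' : Continuous (deriv fun y => b y s) := hbs.continuous_deriv le_rfl
  have cux : Continuous (deriv fun y => u y s) := (hu.contDiff_deriv_space hs0).continuous
  have cuxx : Continuous (iteratedDeriv 2 fun y => u y s) :=
    (hu.contDiff_space s hs0).continuous_iteratedDeriv 2 le_rfl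
  have hmono : univ ×ˢ O ⊆ (univ : Set ℝ) ×ˢ Ioi (0 : ℝ) := prod_mono_right hO0
  have cu2 := hu.continuousOn.mono hmono
  have cut2 := hu.continuousOn_dt.mono hmono
  have key := hasDerivAt_intervalIntegral_of_continuousOn (f := fun y t => φ (u y t) * ψ y t)
    (f' := fun y t => φ' (u y t) * deriv (fun s => u y s) t * ψ y t + φ (u y t) * ψs y t) hO hs
    (fun t ht => (cφ.comp (hu.continuous_space (hO0 ht))).mul (cψ t ht))
    (fun y t ht => ((hφ (u y t)).comp t (hu.hasDerivAt_time (hO0 ht) y)).mul (hψd y t ht))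
    ((((cφ'.comp_continuousOn cu2).mul cut2).mul hψ).add ((cφ.comp_continuousOn cu2).mul hψs)) α β
  refine key.congr_deriv ?_
  have cut : Continuous fun y => deriv (fun t => u y t) s := by
    rw [← continuousOn_univ]
    exact cut2.comp (f := fun y : ℝ => ((y, s) : ℝ × ℝ)) (by fun_prop) fun y _ => ⟨mem_univ _, hs⟩
  have cψ' := cψ s hs
  rw [← sub_eq_zero, ← intervalIntegral.integral_sub]
  rotate_left
  · exact Continuous.intervalIntegrable (by fun_prop) _ _
  · exact Continuous.intervalIntegrable (by fun_prop) _ _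
  -- the difference of the integrands is the derivative of the flux below
  have hG : ∀ y, HasDerivAt (fun y => φ' (u y s) * (deriv (fun y => u y s) y
        - (b y s - c) * u y s) * ψ y s - φ (u y s) * ψy y - c * φ (u y s) * ψ y s)
      ((φ'' (u y s) * deriv (fun y => u y s) y * (deriv (fun y => u y s) y - (b y s - c) * u y s)
        + φ' (u y s) * (iteratedDeriv 2 (fun y => u y s) y - (deriv (fun y => b y s) y * u y s
          + (b y s - c) * deriv (fun y => u y s) y))) * ψ y s
        + φ' (u y s) * (deriv (fun y => u y s) y - (b y s - c) * u y s) * ψy y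
        - (φ' (u y s) * deriv (fun y => u y s) y * ψy y + φ (u y s) * ψyy y)
        - (c * (φ' (u y s) * deriv (fun y => u y s) y) * ψ y s
          + c * φ (u y s) * ψy y)) y := fun y => by
    have du := hu.hasDerivAt_space hs0 y
    have dφ := (hφ (u y s)).comp y du
    have dφ' := (hφ' (u y s)).comp y du
    have dbu := ((hbd y).sub_const c).mul du
    exact (((dφ'.mul ((hu.hasDerivAt_deriv_space hs0 y).sub dbu)).mul (hψy y)).sub
      (dφ.mul (hψyy y))).sub ((dφ.const_mul c).mul (hψy y))
  have hint := intervalIntegral.integral_eq_sub_of_hasDerivAt (a := α) (b := β) (fun y _ => hG y)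
    (Continuous.intervalIntegrable (by fun_prop) _ _)
  simp only [h1, h2, h3, h4, mul_zero, sub_self] at hint
  rw [← hint]
  refine intervalIntegral.integral_congr fun y _ => ?_
  have heq := hu.equation y s hs0
  have hbu : deriv (fun y => b y s * u y s) y = _ :=
    ((hbd y).mul (hu.hasDerivAt_space hs0 y)).deriv
  rw [hbu] at heq
  linear_combination (φ' (u y s) * ψ y s) * heq

/-! ### The energy inequality in `L^{2r}` -/

theorem IsAdvectionField.bddAbove {b : ℝ → ℝ → ℝ} (hb : IsAdvectionField b) {t : ℝ} (ht : 0 ≤ t) :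
    BddAbove (range fun x => b x t) := by
  obtain ⟨C, hC⟩ := hb.bounded
  exact ⟨C, by rintro _ ⟨x, rfl⟩; exact (abs_le.1 (hC x t ht)).2⟩

theorem IsAdvectionField.bddBelow {b : ℝ → ℝ → ℝ} (hb : IsAdvectionField b) {t : ℝ} (ht : 0 ≤ t) :
    BddBelow (range fun x => b x t) := by
  obtain ⟨C, hC⟩ := hb.bounded
  exact ⟨-C, by rintro _ ⟨x, rfl⟩; exact (abs_le.1 (hC x t ht)).1⟩

/-- The midrange of `b(·, t)` is at distance at most `B(t)` from every value of `b(·, t)`. -/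
theorem IsAdvectionField.exists_center {b : ℝ → ℝ → ℝ} (hb : IsAdvectionField b) {C : ℝ}
    (hC : ∀ x t : ℝ, 0 ≤ t → |b x t| ≤ C) {t : ℝ} (ht : 0 ≤ t) :
    ∃ c : ℝ, |c| ≤ C ∧ ∀ x, |b x t - c| ≤ halfOsc b t := by
  have h1 := le_ciSup (hb.bddAbove ht)
  have h2 := ciInf_le (hb.bddBelow ht)
  have h3 : (⨆ x, b x t) ≤ C := ciSup_le fun x => (abs_le.1 (hC x t ht)).2
  have h4 : -C ≤ ⨅ x, b x t := le_ciInf fun x => (abs_le.1 (hC x t ht)).1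
  refine ⟨((⨆ x, b x t) + ⨅ x, b x t) / 2, ?_, fun x => ?_⟩
  · have := (h2 0).trans (h1 0)
    rw [abs_le]; constructor <;> linarith
  · have := h1 x; have := h2 x
    simp only [halfOsc] at *
    rw [abs_le]; constructor <;> linarith

/-- Minkowski's inequality in `L²` of an interval. -/
theorem integral_add_sq_le {f g : ℝ → ℝ} (hf : Continuous f) (hg : Continuous g) {a b : ℝ}
    (hab : a ≤ b) : ∫ x in a..b, (f x + g x) ^ 2
      ≤ (√(∫ x in a..b, f x ^ 2) + √(∫ x in a..b, g x ^ 2)) ^ 2 := by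
  have h1 : 0 ≤ ∫ x in a..b, f x ^ 2 := intervalIntegral.integral_nonneg hab fun x _ => sq_nonneg _
  have h2 : 0 ≤ ∫ x in a..b, g x ^ 2 := intervalIntegral.integral_nonneg hab fun x _ => sq_nonneg _
  have h3 : ∫ x in a..b, f x * g x ≤ √(∫ x in a..b, f x ^ 2) * √(∫ x in a..b, g x ^ 2) := by
    rw [← Real.sqrt_mul h1]
    exact Real.le_sqrt_of_sq_le (sq_integral_mul_le hf hg hab)
  have h : ∫ x in a..b, (f x + g x) ^ 2 = (∫ x in a..b, f x ^ 2) + (∫ x in a..b, g x ^ 2)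
      + 2 * ∫ x in a..b, f x * g x := by
    rw [← intervalIntegral.integral_const_mul, ← intervalIntegral.integral_add,
      ← intervalIntegral.integral_add]
    · exact intervalIntegral.integral_congr fun x _ => by ring
    all_goals exact Continuous.intervalIntegrable (by fun_prop) _ _
  rw [h, add_sq, Real.sq_sqrt h1, Real.sq_sqrt h2]
  linarith

theorem abs_rpow_sub_one_mul_self_sq {r : ℝ} (hr : 1 ≤ r) (v : ℝ) :
    (|v| ^ (r - 1) * v) ^ 2 = |v| ^ (2 * r) := by
  rw [mul_pow, ← sq_abs v, ← mul_pow, ← Real.rpow_add_one' (abs_nonneg v) (by linarith),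
    sub_add_cancel, ← Real.rpow_natCast, ← Real.rpow_mul (abs_nonneg v)]
  congr 1
  push_cast
  ring

theorem abs_rpow_sub_one_sq {r : ℝ} (v : ℝ) :
    (|v| ^ (r - 1)) ^ 2 = |v| ^ (2 * r - 2) := by
  rw [← Real.rpow_natCast, ← Real.rpow_mul (abs_nonneg v)]
  congr 1
  push_cast
  ring

theorem hasDerivAt_weight (R y : ℝ) : HasDerivAt (fun y : ℝ => (1 - y ^ 2 / R ^ 2) ^ 2)
    (-(4 * y / R ^ 2 * (1 - y ^ 2 / R ^ 2))) y := by
  have := (((hasDerivAt_pow 2 y).div_const (R ^ 2)).const_sub 1).pow 2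
  refine this.congr_deriv ?_
  push_cast
  ring

theorem hasDerivAt_weight_deriv (R y : ℝ) :
    HasDerivAt (fun y : ℝ => -(4 * y / R ^ 2 * (1 - y ^ 2 / R ^ 2)))
    (-(4 / R ^ 2) + 12 * y ^ 2 / R ^ 4) y := by
  have := ((((hasDerivAt_id y).const_mul 4).div_const (R ^ 2)).mul
    (((hasDerivAt_pow 2 y).div_const (R ^ 2)).const_sub 1)).neg
  refine this.congr_deriv ?_
  simp only [id]
  push_cast
  ring

theorem sq_div_sq_le_one {R y : ℝ} (hR : 0 < R) (hy : y ∈ Icc (-R) R) : y ^ 2 / R ^ 2 ≤ 1 := by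
  rw [div_le_one (by positivity)]
  exact sq_le_sq' hy.1 hy.2

theorem abs_weight_deriv_le {R y : ℝ} (hR : 0 < R) (hy : y ∈ Icc (-R) R) :
    |-(4 * y / R ^ 2 * (1 - y ^ 2 / R ^ 2))| ≤ 4 / R := by
  have h1 := sq_div_sq_le_one hR hy
  have h2 : 0 ≤ y ^ 2 / R ^ 2 := by positivity
  have h3 : |y| ≤ R := abs_le.2 hy
  rw [abs_neg, abs_mul, abs_of_nonneg (by linarith : 0 ≤ 1 - y ^ 2 / R ^ 2), abs_div, abs_mul,
    abs_of_pos (by positivity : 0 < R ^ 2), abs_of_pos (by norm_num : (0 : ℝ) < 4)]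
  calc 4 * |y| / R ^ 2 * (1 - y ^ 2 / R ^ 2) ≤ 4 * R / R ^ 2 * 1 := by gcongr; linarith
    _ = 4 / R := by field_simp

theorem abs_weight_deriv2_le {R y : ℝ} (hR : 1 ≤ R) (hy : y ∈ Icc (-R) R) :
    |-(4 / R ^ 2) + 12 * y ^ 2 / R ^ 4| ≤ 8 / R := by
  have hR0 : 0 < R := by linarith
  have h1 := sq_div_sq_le_one hR0 hy
  have h2 : 0 ≤ y ^ 2 / R ^ 2 := by positivity
  have h3 : 1 / R ^ 2 ≤ 1 / R := one_div_le_one_div_of_le hR0 (by nlinarith)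
  have e : -(4 / R ^ 2) + 12 * y ^ 2 / R ^ 4 = (1 / R ^ 2) * (-4 + 12 * (y ^ 2 / R ^ 2)) := by
    field_simp
  have h4 : 0 ≤ 1 / R ^ 2 := by positivity
  rw [e, abs_mul, abs_of_nonneg h4]
  have h5 : |-4 + 12 * (y ^ 2 / R ^ 2)| ≤ 8 := by rw [abs_le]; constructor <;> linarith
  calc 1 / R ^ 2 * |-4 + 12 * (y ^ 2 / R ^ 2)| ≤ 1 / R * 8 := by gcongr
    _ = 8 / R := by ring

/-- The differential inequality for `F = ∫ |u|^{2r} η²`, `η = 1 - x² / R²`: the derivative of `F`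
is controlled by the dissipation `D`, the oscillation of `b` and a term of order `1 / R`. -/
theorem IsSolution.exists_hasDerivAt_energy {b : ℝ → ℝ → ℝ} {u₀ : ℝ → ℝ} {u : ℝ → ℝ → ℝ}
    (hb : IsAdvectionField b) (hu : IsSolution b u₀ u) {C : ℝ}
    (hC : ∀ x t : ℝ, 0 ≤ t → |b x t| ≤ C) {r R s : ℝ} (hr : 1 ≤ r) (hR : 1 ≤ R) (hs : 0 < s) :
    ∃ F' : ℝ, HasDerivAt (fun t => ∫ y in -R..R, |u y t| ^ (2 * r) * (1 - y ^ 2 / R ^ 2) ^ 2) F' s ∧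
      F' ≤ 2 * r * (2 * r - 1) *
        (-(∫ y in -R..R, (|u y s| ^ (r - 1) * deriv (fun y => u y s) y * (1 - y ^ 2 / R ^ 2)) ^ 2)
          + halfOsc b s
            * √(∫ y in -R..R, (|u y s| ^ (r - 1) * deriv (fun y => u y s) y
                * (1 - y ^ 2 / R ^ 2)) ^ 2)
            * √(∫ y in -R..R, |u y s| ^ (2 * r) * (1 - y ^ 2 / R ^ 2) ^ 2))
        + (8 + 4 * C + 16 * r * C) / R * ∫ y in -R..R, |u y s| ^ (2 * r) := by
  obtain ⟨c, hc, hosc⟩ := hb.exists_center hC hs.le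
  have hR0 : 0 < R := by linarith
  have hRR : -R ≤ R := by linarith
  have hC0 : 0 ≤ C := (abs_nonneg _).trans hc
  have hosc0 : 0 ≤ halfOsc b s := (abs_nonneg _).trans (hosc 0)
  have hend : ∀ x : ℝ, x = -R ∨ x = R → 1 - x ^ 2 / R ^ 2 = 0 := by
    rintro x (rfl | rfl) <;> field_simp <;> ring
  have hφ : ∀ v : ℝ, HasDerivAt (fun v : ℝ => |v| ^ (2 * r)) (2 * r * (|v| ^ (2 * r - 2) * v)) v :=
    fun v => (hasDerivAt_abs_rpow v (by linarith)).congr_deriv (by ring)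
  have hφ' : ∀ v : ℝ, HasDerivAt (fun v : ℝ => 2 * r * (|v| ^ (2 * r - 2) * v))
      (2 * r * (2 * r - 1) * |v| ^ (2 * r - 2)) v := fun v =>
    ((hasDerivAt_abs_rpow_mul_self (by linarith : 0 ≤ 2 * r - 2) v).const_mul (2 * r)).congr_deriv
      (by ring)
  have cpow : Continuous fun v : ℝ => |v| ^ (2 * r - 2) := continuous_abs_rpow (by linarith)
  have cpow1 : Continuous fun v : ℝ => |v| ^ (r - 1) := continuous_abs_rpow (by linarith)
  have cpow2 : Continuous fun v : ℝ => |v| ^ (2 * r) := continuous_abs_rpow (by linarith)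
  have key := hu.hasDerivAt_integral_mul_weight hb hφ hφ' (by fun_prop) isOpen_Ioi Subset.rfl
    (ψ := fun y _ => (1 - y ^ 2 / R ^ 2) ^ 2) (ψs := fun _ _ => 0) (by fun_prop) (by fun_prop)
    (fun y t _ => hasDerivAt_const _ _) hs (hasDerivAt_weight R) (hasDerivAt_weight_deriv R)
    (by fun_prop) (α := -R) (β := R) (by simp only [hend (-R) (Or.inl rfl)]; norm_num)
    (by simp only [hend R (Or.inr rfl)]; norm_num)
    (by simp only [hend (-R) (Or.inl rfl)]; norm_num)
    (by simp only [hend R (Or.inr rfl)]; norm_num) c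
  refine ⟨_, key, ?_⟩
  have cus := hu.continuous_space hs
  have cux : Continuous (deriv fun y => u y s) := (hu.contDiff_deriv_space hs).continuous
  have cb := (hb.contDiff_space hs.le).continuous
  have c0 : Continuous fun y => |u y s| ^ (2 * r - 2) := cpow.comp cus
  have c1 : Continuous fun y => |u y s| ^ (r - 1) := cpow1.comp cus
  have c2 : Continuous fun y => |u y s| ^ (2 * r) := cpow2.comp cus
  set w := fun y => |u y s| ^ (r - 1) * deriv (fun y => u y s) y * (1 - y ^ 2 / R ^ 2) with hw
  set g := fun y => |u y s| ^ (r - 1) * u y s * (1 - y ^ 2 / R ^ 2) with hg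
  have cw : Continuous w := by fun_prop
  have cg : Continuous g := by fun_prop
  have hgF : (∫ y in -R..R, |u y s| ^ (2 * r) * (1 - y ^ 2 / R ^ 2) ^ 2)
      = ∫ y in -R..R, g y ^ 2 := by
    refine intervalIntegral.integral_congr fun y _ => ?_
    simp only [hg]
    rw [mul_pow, abs_rpow_sub_one_mul_self_sq hr]
  have hD0 : 0 ≤ ∫ y in -R..R, w y ^ 2 :=
    intervalIntegral.integral_nonneg hRR fun x _ => sq_nonneg _
  have hcs : ∫ y in -R..R, |w y| * |g y| ≤ √(∫ y in -R..R, w y ^ 2) * √(∫ y in -R..R, g y ^ 2) := by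
    rw [← Real.sqrt_mul hD0]
    refine Real.le_sqrt_of_sq_le ?_
    simpa only [sq_abs] using sq_integral_mul_le cw.abs cg.abs hRR
  rw [hgF]
  -- the weight's derivatives contribute `O(1 / R)`; in the remaining advection term `b - c` is
  -- bounded by the half oscillation
  have hpt : ∀ y ∈ Icc (-R) R,
      |u y s| ^ (2 * r) * (0 + (-(4 / R ^ 2) + 12 * y ^ 2 / R ^ 4)
          + c * -(4 * y / R ^ 2 * (1 - y ^ 2 / R ^ 2)))
        - 2 * r * (2 * r - 1) * |u y s| ^ (2 * r - 2) * deriv (fun y => u y s) y ^ 2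
          * (1 - y ^ 2 / R ^ 2) ^ 2
        + (b y s - c) * u y s * (2 * r * (2 * r - 1) * |u y s| ^ (2 * r - 2)
            * deriv (fun y => u y s) y * (1 - y ^ 2 / R ^ 2) ^ 2
          + 2 * r * (|u y s| ^ (2 * r - 2) * u y s) * -(4 * y / R ^ 2 * (1 - y ^ 2 / R ^ 2)))
      ≤ 2 * r * (2 * r - 1) * (-(w y ^ 2) + halfOsc b s * (|w y| * |g y|))
        + (8 + 4 * C + 16 * r * C) / R * |u y s| ^ (2 * r) := by
    intro y hy
    have k1 := abs_weight_deriv_le hR0 hy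
    have k2 := abs_weight_deriv2_le hR hy
    set z1 := -(4 * y / R ^ 2 * (1 - y ^ 2 / R ^ 2))
    set z2 := -(4 / R ^ 2) + 12 * y ^ 2 / R ^ 4
    have hP : |u y s| ^ (2 * r - 2) * u y s * u y s = |u y s| ^ (2 * r) := by
      rw [← abs_rpow_sub_one_sq, ← abs_rpow_sub_one_mul_self_sq hr]; ring
    have hwy : |u y s| ^ (2 * r - 2) * deriv (fun y => u y s) y ^ 2 * (1 - y ^ 2 / R ^ 2) ^ 2
        = w y ^ 2 := by
      simp only [hw]; rw [← abs_rpow_sub_one_sq]; ring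
    have hwg : |u y s| ^ (2 * r - 2) * u y s * deriv (fun y => u y s) y * (1 - y ^ 2 / R ^ 2) ^ 2
        = w y * g y := by
      simp only [hw, hg]; rw [← abs_rpow_sub_one_sq]; ring
    set P := |u y s| ^ (2 * r) with hPdef
    have hP0 : 0 ≤ P := by positivity
    have e1 : P * (0 + z2 + c * z1) ≤ P * (8 / R + C * (4 / R)) := by
      rw [zero_add]
      refine mul_le_mul_of_nonneg_left (add_le_add ((le_abs_self _).trans k2)
        ((le_abs_self _).trans ?_)) hP0
      rw [abs_mul]; gcongr
    have e2 : (b y s - c) * z1 ≤ (2 * C) * (4 / R) := by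
      refine (le_abs_self _).trans ?_
      rw [abs_mul]
      gcongr
      refine (abs_sub _ _).trans ?_
      linarith [hC y s hs.le]
    have e3 : (b y s - c) * (w y * g y) ≤ halfOsc b s * (|w y| * |g y|) := by
      refine (le_abs_self _).trans ?_
      rw [abs_mul, abs_mul]; gcongr; exact hosc y
    have e4 : 2 * r * (2 * r - 1) * ((b y s - c) * (w y * g y))
        ≤ 2 * r * (2 * r - 1) * (halfOsc b s * (|w y| * |g y|)) :=
      mul_le_mul_of_nonneg_left e3 (by nlinarith)
    have e5 : 2 * r * P * ((b y s - c) * z1) ≤ 2 * r * P * ((2 * C) * (4 / R)) :=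
      mul_le_mul_of_nonneg_left e2 (by positivity)
    have e6 : (b y s - c) * u y s * (2 * r * (2 * r - 1) * |u y s| ^ (2 * r - 2)
            * deriv (fun y => u y s) y * (1 - y ^ 2 / R ^ 2) ^ 2
          + 2 * r * (|u y s| ^ (2 * r - 2) * u y s) * z1)
        = 2 * r * (2 * r - 1) * ((b y s - c) * (w y * g y)) + 2 * r * P * ((b y s - c) * z1) := by
      rw [← hwg, ← hP]; ring
    have e7 : 2 * r * (2 * r - 1) * |u y s| ^ (2 * r - 2) * deriv (fun y => u y s) y ^ 2
          * (1 - y ^ 2 / R ^ 2) ^ 2 = 2 * r * (2 * r - 1) * w y ^ 2 := by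
      rw [← hwy]; ring
    have e8 : (8 + 4 * C + 16 * r * C) / R * P
        = P * (8 / R + C * (4 / R)) + 2 * r * P * ((2 * C) * (4 / R)) := by ring
    rw [e6, e7, e8]
    linarith
  refine (intervalIntegral.integral_mono_on hRR (Continuous.intervalIntegrable (by fun_prop) _ _)
    (Continuous.intervalIntegrable (by fun_prop) _ _) hpt).trans ?_
  rw [intervalIntegral.integral_add, intervalIntegral.integral_const_mul,
    intervalIntegral.integral_const_mul, intervalIntegral.integral_add,
    intervalIntegral.integral_neg, intervalIntegral.integral_const_mul, mul_assoc (halfOsc b s)]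
  · have : 0 ≤ 2 * r * (2 * r - 1) := by nlinarith
    gcongr
  all_goals exact Continuous.intervalIntegrable (by fun_prop) _ _

/-- Nash's inequality for `|u|^{r-1} u η`, `η = 1 - x² / R²`. -/
theorem IsSolution.nash_energy {b : ℝ → ℝ → ℝ} {u₀ : ℝ → ℝ} {u : ℝ → ℝ → ℝ}
    (hu : IsSolution b u₀ u) {r R s N : ℝ} (hr : 1 ≤ r) (hR : 1 ≤ R) (hs : 0 < s)
    (hN : ∫ y in -R..R, |u y s| ^ r ≤ N) :
    16 * Real.pi ^ 2 * (∫ y in -R..R, |u y s| ^ (2 * r) * (1 - y ^ 2 / R ^ 2) ^ 2) ^ 3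
      ≤ 27 * N ^ 4 * (r * √(∫ y in -R..R, (|u y s| ^ (r - 1) * deriv (fun y => u y s) y
          * (1 - y ^ 2 / R ^ 2)) ^ 2) + 2 / R * √(∫ y in -R..R, |u y s| ^ (2 * r))) ^ 2 := by
  have hR0 : 0 < R := by linarith
  have hRR : -R ≤ R := by linarith
  have cus := hu.continuous_space hs
  have cux : Continuous (deriv fun y => u y s) := (hu.contDiff_deriv_space hs).continuous
  have c1 : Continuous fun y => |u y s| ^ (r - 1) :=
    (continuous_abs_rpow (by linarith : 0 ≤ r - 1)).comp cus
  have c2 : Continuous fun y => |u y s| ^ (2 * r) :=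
    (continuous_abs_rpow (by linarith : 0 ≤ 2 * r)).comp cus
  have c3 : Continuous fun y => |u y s| ^ r := (continuous_abs_rpow (by linarith)).comp cus
  have hη : ∀ y, HasDerivAt (fun y : ℝ => 1 - y ^ 2 / R ^ 2) (-(2 * y / R ^ 2)) y := fun y =>
    (((hasDerivAt_pow 2 y).div_const (R ^ 2)).const_sub 1).congr_deriv (by push_cast; ring)
  have hg : ∀ y, HasDerivAt (fun y => |u y s| ^ (r - 1) * u y s * (1 - y ^ 2 / R ^ 2))
      (r * (|u y s| ^ (r - 1) * deriv (fun y => u y s) y * (1 - y ^ 2 / R ^ 2))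
        + |u y s| ^ (r - 1) * u y s * -(2 * y / R ^ 2)) y := fun y => by
    have d1 := (hasDerivAt_abs_rpow_mul_self (by linarith : 0 ≤ r - 1) (u y s)).comp y
      (hu.hasDerivAt_space hs y)
    refine (d1.mul (hη y)).congr_deriv ?_
    simp only [Function.comp]
    ring
  have h := nash_inequality hg (by fun_prop) hRR (by field_simp; simp) (by field_simp; simp)
  have hF : (∫ y in -R..R, |u y s| ^ (2 * r) * (1 - y ^ 2 / R ^ 2) ^ 2)
      = ∫ y in -R..R, (|u y s| ^ (r - 1) * u y s * (1 - y ^ 2 / R ^ 2)) ^ 2 := by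
    refine intervalIntegral.integral_congr fun y _ => ?_
    rw [mul_pow _ (1 - y ^ 2 / R ^ 2), abs_rpow_sub_one_mul_self_sq hr]
  rw [hF]
  refine h.trans ?_
  have hpow : ∀ v : ℝ, |v| ^ (r - 1) * |v| = |v| ^ r := fun v => by
    rw [← Real.rpow_add_one' (abs_nonneg v) (by linarith), sub_add_cancel]
  have hN1 : ∫ y in -R..R, |(|u y s| ^ (r - 1) * u y s * (1 - y ^ 2 / R ^ 2))| ≤ N := by
    refine le_trans ?_ hN
    refine intervalIntegral.integral_mono_on hRR (Continuous.intervalIntegrable (by fun_prop) _ _)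
      (Continuous.intervalIntegrable (by fun_prop) _ _) fun y hy => ?_
    have h1 := sq_div_sq_le_one hR0 hy
    have h2 : 0 ≤ y ^ 2 / R ^ 2 := by positivity
    rw [abs_mul, abs_mul, abs_of_nonneg (by positivity : 0 ≤ |u y s| ^ (r - 1)), hpow,
      abs_of_nonneg (by linarith : 0 ≤ 1 - y ^ 2 / R ^ 2)]
    exact mul_le_of_le_one_right (by positivity) (by linarith)
  have hN0 : 0 ≤ ∫ y in -R..R, |(|u y s| ^ (r - 1) * u y s * (1 - y ^ 2 / R ^ 2))| :=
    intervalIntegral.integral_nonneg hRR fun x _ => abs_nonneg _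
  have hA : √(∫ y in -R..R, (r * (|u y s| ^ (r - 1) * deriv (fun y => u y s) y
      * (1 - y ^ 2 / R ^ 2))) ^ 2) = r * √(∫ y in -R..R, (|u y s| ^ (r - 1)
        * deriv (fun y => u y s) y * (1 - y ^ 2 / R ^ 2)) ^ 2) := by
    simp only [mul_pow r]
    rw [intervalIntegral.integral_const_mul, Real.sqrt_mul (sq_nonneg r),
      Real.sqrt_sq (by linarith)]
  have hB : √(∫ y in -R..R, (|u y s| ^ (r - 1) * u y s * -(2 * y / R ^ 2)) ^ 2)
      ≤ 2 / R * √(∫ y in -R..R, |u y s| ^ (2 * r)) := by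
    rw [← Real.sqrt_sq (by positivity : 0 ≤ 2 / R), ← Real.sqrt_mul (sq_nonneg _),
      ← intervalIntegral.integral_const_mul]
    refine Real.sqrt_le_sqrt ?_
    refine intervalIntegral.integral_mono_on hRR (Continuous.intervalIntegrable (by fun_prop) _ _)
      (Continuous.intervalIntegrable (by fun_prop) _ _) fun y hy => ?_
    rw [mul_pow, abs_rpow_sub_one_mul_self_sq hr, mul_comm]
    gcongr ?_ * _
    have e : (-(2 * y / R ^ 2)) ^ 2 = (2 / R) ^ 2 * (y ^ 2 / R ^ 2) := by ring
    rw [e]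
    exact mul_le_of_le_one_right (sq_nonneg _) (sq_div_sq_le_one hR0 hy)
  have hM := integral_add_sq_le (f := fun y => r * (|u y s| ^ (r - 1) * deriv (fun y => u y s) y
      * (1 - y ^ 2 / R ^ 2))) (g := fun y => |u y s| ^ (r - 1) * u y s * -(2 * y / R ^ 2))
      (by fun_prop) (by fun_prop) hRR
  rw [hA] at hM
  have hM2 := hM.trans (pow_le_pow_left₀ (by positivity) (add_le_add_right hB _) 2)
  exact mul_le_mul (by gcongr) hM2 (intervalIntegral.integral_nonneg hRR fun x _ => sq_nonneg _)
    (mul_nonneg (by norm_num) (pow_nonneg (hN0.trans hN1) 4))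

/-! ### Doubling the exponent -/

theorem nashConst_pow_three : nashConst ^ 3 = 3 * √3 / (4 * Real.pi) := by
  have h : (0 : ℝ) ≤ 3 * √3 / (4 * Real.pi) := by positivity
  rw [nashConst, ← Real.rpow_natCast, ← Real.rpow_mul h]
  norm_num

/-- If `F³ ≤ k² (r √D + δ)²` and `F ≥ l > r k β`, then the dissipation beats the advection term. -/
theorem neg_add_mul_sqrt_le {F D k r β δ l θ : ℝ} (hl : 0 < l) (hF : l ≤ F) (hk : 0 < k)
    (hr : 0 < r) (hβ : 0 ≤ β) (hδ : 0 ≤ δ) (hθ : 0 < θ) (hlk : r * k * (β + θ) ≤ l)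
    (hδθ : δ / r ≤ θ / 2 * √l) (hD : 0 ≤ D) (h : F ^ 3 ≤ k ^ 2 * (r * √D + δ) ^ 2) :
    -D + β * √D * √F ≤ -(θ ^ 2 / 4 * l) := by
  have hF0 : 0 < F := hl.trans_le hF
  have hsF : √F ^ 2 = F := Real.sq_sqrt hF0.le
  have hsD : √D ^ 2 = D := Real.sq_sqrt hD
  have hD' := Real.sqrt_nonneg D
  have hF' := Real.sqrt_pos.2 hF0
  have h1 : F * √F ≤ k * (r * √D + δ) := by
    refine le_of_sq_le_sq ?_ (by positivity)
    calc (F * √F) ^ 2 = F ^ 3 := by rw [mul_pow, hsF]; ring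
      _ ≤ k ^ 2 * (r * √D + δ) ^ 2 := h
      _ = _ := by ring
  have h2 : r * k * (β + θ) * √F ≤ k * (r * √D + δ) :=
    (mul_le_mul_of_nonneg_right (hlk.trans hF) hF'.le).trans h1
  have h3 : (β + θ) * √F ≤ √D + δ / r := by
    have e : k * (r * √D + δ) = r * k * (√D + δ / r) := by field_simp
    rw [e, mul_assoc] at h2
    exact le_of_mul_le_mul_left h2 (by positivity)
  have h4 : √l ≤ √F := Real.sqrt_le_sqrt hF
  have h5 : (β + θ / 2) * √F ≤ √D := by nlinarith
  have h6 : (θ / 2 * √F) * (θ / 2 * √F) ≤ √D * (√D - β * √F) := by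
    refine mul_le_mul ?_ ?_ (by positivity) hD'
    · nlinarith [mul_nonneg hβ hF'.le]
    · linarith
  have h7 : (θ / 2 * √F) * (θ / 2 * √F) = θ ^ 2 / 4 * F := by
    linear_combination θ ^ 2 / 4 * hsF
  rw [h7] at h6
  have h8 : θ ^ 2 / 4 * l ≤ θ ^ 2 / 4 * F := by gcongr
  nlinarith

/-- An eventual bound `N` for `∫ |u|^r` gives an eventual bound for `∫ |u|^{2r}`, by any number
above `r C N² β`, with `C` the cube of the Nash constant. While `∫ |u|^{2r}` exceeds that number,
Nash's inequality makes the dissipation win over the advection, at a uniform rate. -/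
theorem IsSolution.eventually_lintegral_two_mul_le {b : ℝ → ℝ → ℝ} {u₀ : ℝ → ℝ} {u : ℝ → ℝ → ℝ}
    (hb : IsAdvectionField b) (hu : IsSolution b u₀ u) {r N β l : ℝ} (hr : 1 ≤ r) (hN : 0 < N)
    (hβ : 0 ≤ β) (hosc : ∀ᶠ t in atTop, halfOsc b t ≤ β)
    (hLr : ∀ᶠ t in atTop, ∫⁻ x, ENNReal.ofReal (|u x t| ^ r) ≤ ENNReal.ofReal N)
    (hl : r * (3 * √3 / (4 * Real.pi) * N ^ 2) * β < l) :
    ∀ᶠ t in atTop, ∫⁻ x, ENNReal.ofReal (|u x t| ^ (2 * r)) ≤ ENNReal.ofReal l := by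
  obtain ⟨C, hC⟩ := hb.bounded
  have hC0 : 0 ≤ C := (abs_nonneg _).trans (hC 0 0 le_rfl)
  obtain ⟨t₁, ht₁⟩ := eventually_atTop.1 ((hosc.and hLr).and (eventually_gt_atTop 0))
  have ht10 : 0 < t₁ := (ht₁ t₁ le_rfl).2
  set k := 3 * √3 / (4 * Real.pi) * N ^ 2 with hk
  have hr0 : 0 < r := by linarith
  have hk0 : 0 < k := by positivity
  have hl0 : 0 < l := lt_of_le_of_lt (by positivity) hl
  -- `θ` measures the gap between `l` and `r k β`; half of it absorbs the boundary error in Nash's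
  -- inequality, and half of the resulting rate `2 κ` the one in the energy inequality
  set θ := (l - r * k * β) / (r * k) with hθ
  have hθ0 : 0 < θ := div_pos (by linarith) (by positivity)
  have hlk : r * k * (β + θ) ≤ l := le_of_eq (by rw [hθ]; field_simp; ring)
  set κ := 2 * r * (2 * r - 1) * (θ ^ 2 / 8 * l) with hκ
  have hq0 : 0 < 2 * r * (2 * r - 1) := mul_pos (by linarith) (by linarith)
  have hκ0 : 0 < κ := by positivity
  -- the integrals of `|u|^{2r}` are locally bounded in time, as `u` is
  have hE : ∀ T : ℝ, ∃ M : ℝ, 0 ≤ M ∧ ∀ t, t₁ ≤ t → t ≤ T → ∀ R : ℝ, 0 ≤ R →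
      ∫ y in -R..R, |u y t| ^ (2 * r) ≤ M := by
    intro T
    obtain ⟨M, hM⟩ := hu.bounded_strip (max T 1) (by positivity)
    refine ⟨|M| ^ r * N, by positivity, fun t ht htT R hR => ?_⟩
    have ht0 := ht10.trans_le ht
    have cr : Continuous fun y => |u y t| ^ r :=
      (continuous_abs_rpow hr0.le).comp (hu.continuous_space ht0)
    have cq : Continuous fun y => |u y t| ^ (2 * r) :=
      (continuous_abs_rpow (by linarith)).comp (hu.continuous_space ht0)
    have h1 : ∫ y in -R..R, |u y t| ^ r ≤ N := intervalIntegral_le_of_lintegral_le cr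
      (fun _ => by positivity) hN.le (ht₁ t ht).1.2 (by linarith)
    calc ∫ y in -R..R, |u y t| ^ (2 * r) ≤ ∫ y in -R..R, |M| ^ r * |u y t| ^ r := by
          refine intervalIntegral.integral_mono_on (by linarith) (cq.intervalIntegrable _ _)
            ((cr.const_mul _).intervalIntegrable _ _) fun y _ => ?_
          rw [two_mul, Real.rpow_add' (abs_nonneg _) (by linarith)]
          exact mul_le_mul_of_nonneg_right (Real.rpow_le_rpow (abs_nonneg _)
            ((hM y t ht0.le (htT.trans (le_max_left _ _))).trans (le_abs_self M)) hr0.le)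
            (by positivity)
      _ = |M| ^ r * ∫ y in -R..R, |u y t| ^ r := intervalIntegral.integral_const_mul _ _
      _ ≤ |M| ^ r * N := by gcongr
  obtain ⟨M₁, hM₁0, hM₁⟩ := hE t₁
  filter_upwards [eventually_ge_atTop (t₁ + M₁ / κ)] with T hT
  have ht1T : t₁ ≤ T := le_trans (by have : 0 ≤ M₁ / κ := by positivity
                                     linarith) hT
  have hT0 := ht10.trans_le ht1T
  obtain ⟨M, hM0, hM⟩ := hE T
  have cq : ∀ t, 0 < t → Continuous fun y => |u y t| ^ (2 * r) := fun t ht =>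
    (continuous_abs_rpow (by linarith)).comp (hu.continuous_space ht)
  refine lintegral_le_of_weighted_le (cq T hT0) (fun _ => by positivity) ?_
  have hlim : ∀ a : ℝ, Tendsto (fun R : ℝ => a / R) atTop (𝓝 0) := fun a =>
    tendsto_const_nhds.div_atTop tendsto_id
  have hsl : 0 < θ / 2 * √l := by positivity
  filter_upwards [eventually_ge_atTop 1, (hlim (2 * √M / r)).eventually (ge_mem_nhds hsl),
    (hlim ((8 + 4 * C + 16 * r * C) * M)).eventually (ge_mem_nhds hκ0)] with R hR hR1 hR2
  have hR0 : 0 < R := by linarith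
  have hRR : -R ≤ R := by linarith
  choose! F' hF' hF'le using fun (t : ℝ) (ht : 0 < t) =>
    hu.exists_hasDerivAt_energy hb hC hr hR ht
  refine le_of_deriv_le_neg_of_ge (F := fun t => ∫ y in -R..R, |u y t| ^ (2 * r)
    * (1 - y ^ 2 / R ^ 2) ^ 2) hκ0 ht1T (fun t ht => hF' t (ht10.trans_le ht.1)) ?_ ?_
  · intro t ht hlt
    have ht0 := ht10.trans_le ht.1
    have hEt := hM t ht.1 ht.2 R hR0.le
    have hEt0 : 0 ≤ ∫ y in -R..R, |u y t| ^ (2 * r) :=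
      intervalIntegral.integral_nonneg hRR fun _ _ => by positivity
    have cr : Continuous fun y => |u y t| ^ r :=
      (continuous_abs_rpow hr0.le).comp (hu.continuous_space ht0)
    have hnash := hu.nash_energy hr hR ht0 (intervalIntegral_le_of_lintegral_le cr
      (fun _ => by positivity) hN.le (ht₁ t ht.1).1.2 hRR)
    refine (hF'le t ht0).trans ?_
    set D := ∫ y in -R..R, (|u y t| ^ (r - 1) * deriv (fun y => u y t) y
      * (1 - y ^ 2 / R ^ 2)) ^ 2
    set F := ∫ y in -R..R, |u y t| ^ (2 * r) * (1 - y ^ 2 / R ^ 2) ^ 2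
    set E := ∫ y in -R..R, |u y t| ^ (2 * r)
    have hD0 : 0 ≤ D := intervalIntegral.integral_nonneg hRR fun _ _ => sq_nonneg _
    have hk2 : 16 * Real.pi ^ 2 * k ^ 2 = 27 * N ^ 4 := by
      rw [hk]; field_simp; rw [Real.sq_sqrt (by norm_num)]; norm_num
    have hF3 : F ^ 3 ≤ k ^ 2 * (r * √D + 2 / R * √E) ^ 2 := by
      rw [← hk2, mul_assoc _ (k ^ 2)] at hnash
      exact le_of_mul_le_mul_left hnash (by positivity)
    have hδ : 2 / R * √E / r ≤ θ / 2 * √l := by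
      refine le_trans ?_ hR1
      calc 2 / R * √E / r ≤ 2 / R * √M / r := by gcongr
        _ = 2 * √M / r / R := by ring
    have main := neg_add_mul_sqrt_le hl0 hlt hk0 hr0 hβ (by positivity) hθ0 hlk hδ hD0 hF3
    have hoscle : halfOsc b t * √D * √F ≤ β * √D * √F := by
      gcongr; exact (ht₁ t ht.1).1.1
    have herr : (8 + 4 * C + 16 * r * C) / R * E ≤ κ := by
      refine le_trans ?_ hR2
      calc (8 + 4 * C + 16 * r * C) / R * E ≤ (8 + 4 * C + 16 * r * C) / R * M := by gcongr
        _ = _ := by ring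
    have h1 := mul_le_mul_of_nonneg_left ((add_le_add_right hoscle (-D)).trans main) hq0.le
    have h2 : 2 * r * (2 * r - 1) * -(θ ^ 2 / 4 * l) = -(2 * κ) := by rw [hκ]; ring
    linarith
  · have h0 : ∫ y in -R..R, |u y t₁| ^ (2 * r) * (1 - y ^ 2 / R ^ 2) ^ 2 ≤ M₁ := by
      refine le_trans ?_ (hM₁ t₁ le_rfl le_rfl R hR0.le)
      have := cq t₁ ht10
      refine intervalIntegral.integral_mono_on hRR (Continuous.intervalIntegrable (by fun_prop) _ _)
        (Continuous.intervalIntegrable (by fun_prop) _ _) fun y hy => ?_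
      have h1 := sq_div_sq_le_one hR0 hy
      have h2 : 0 ≤ y ^ 2 / R ^ 2 := by positivity
      exact mul_le_of_le_one_right (by positivity) (pow_le_one₀ (by linarith) (by linarith))
    have h1 : M₁ ≤ κ * (T - t₁) := by
      rw [mul_comm, ← div_le_iff₀ hκ0]; linarith
    linarith

/-- Iterated doubling: with `X = p C β`, every number above `(2 X N)^{2^j} / (2^{j+1} X)` is an
eventual bound for `∫ |u|^{2^j p}`. These numbers `W j` solve `W (j+1) = 2^j X (W j)²`, `W 0 = N`. -/
theorem IsSolution.eventually_lintegral_two_pow_mul_le {b : ℝ → ℝ → ℝ} {u₀ : ℝ → ℝ}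
    {u : ℝ → ℝ → ℝ} (hb : IsAdvectionField b) (hu : IsSolution b u₀ u) {p N β X : ℝ} (hp : 1 ≤ p)
    (hN : 0 < N) (hβ : 0 < β) (hosc : ∀ᶠ t in atTop, halfOsc b t ≤ β)
    (hLp : ∀ᶠ t in atTop, ∫⁻ x, ENNReal.ofReal (|u x t| ^ p) ≤ ENNReal.ofReal N)
    (hX : X = p * (3 * √3 / (4 * Real.pi)) * β) (j : ℕ) :
    ∀ l, (2 * X * N) ^ 2 ^ j / (2 ^ (j + 1) * X) < l →
      ∀ᶠ t in atTop, ∫⁻ x, ENNReal.ofReal (|u x t| ^ (2 ^ j * p)) ≤ ENNReal.ofReal l := by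
  have hX0 : 0 < X := by rw [hX]; positivity
  induction j with
  | zero =>
    intro l hl
    have e : (2 * X * N) ^ 2 ^ 0 / (2 ^ (0 + 1) * X) = N := by
      rw [pow_zero, zero_add, pow_one, pow_one]; field_simp
    rw [e] at hl
    filter_upwards [hLp] with t ht
    rw [pow_zero, one_mul]
    exact ht.trans (ENNReal.ofReal_le_ofReal hl.le)
  | succ j ih =>
    intro l hl
    set W := (2 * X * N) ^ 2 ^ j / (2 ^ (j + 1) * X) with hW
    have hW0 : 0 < W := by positivity
    have hrec : (2 * X * N) ^ 2 ^ (j + 1) / (2 ^ (j + 1 + 1) * X) = 2 ^ j * X * W ^ 2 := by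
      rw [hW, pow_succ 2 j, pow_mul, pow_succ 2 (j + 1), pow_succ 2 j]
      field_simp
    rw [hrec] at hl
    have hcont : Tendsto (fun w : ℝ => 2 ^ j * X * w ^ 2) (𝓝[>] W) (𝓝 (2 ^ j * X * W ^ 2)) :=
      (Continuous.tendsto (by fun_prop) W).mono_left nhdsWithin_le_nhds
    obtain ⟨w, hwl, hwW⟩ := ((hcont.eventually (gt_mem_nhds hl)).and self_mem_nhdsWithin).exists
    have hwW : W < w := hwW
    have hr : 1 ≤ 2 ^ j * p := one_le_mul_of_one_le_of_one_le (one_le_pow₀ (by norm_num)) hp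
    have h := hu.eventually_lintegral_two_mul_le hb hr (hW0.trans hwW) hβ.le hosc (ih w hwW)
      (l := l) (lt_of_le_of_lt (le_of_eq (by rw [hX]; ring)) hwl)
    have e : (2 : ℝ) ^ (j + 1) * p = 2 * (2 ^ j * p) := by ring
    rw [e]
    exact h

/-! ### The `L¹` norm does not exceed its initial value -/

theorem hasDerivAt_sqrt_sq_add_sq {ε : ℝ} (hε : 0 < ε) (v : ℝ) :
    HasDerivAt (fun v : ℝ => √(v ^ 2 + ε ^ 2)) (v / √(v ^ 2 + ε ^ 2)) v := by
  have h : v ^ 2 + ε ^ 2 ≠ 0 := by positivity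
  refine (((hasDerivAt_pow 2 v).add_const (ε ^ 2)).sqrt h).congr_deriv ?_
  push_cast
  field_simp

theorem hasDerivAt_div_sqrt_sq_add_sq {ε : ℝ} (hε : 0 < ε) (v : ℝ) :
    HasDerivAt (fun v : ℝ => v / √(v ^ 2 + ε ^ 2)) (ε ^ 2 / √(v ^ 2 + ε ^ 2) ^ 3) v := by
  have h : 0 < √(v ^ 2 + ε ^ 2) := Real.sqrt_pos.2 (by positivity)
  have h2 : √(v ^ 2 + ε ^ 2) ^ 2 = v ^ 2 + ε ^ 2 := Real.sq_sqrt (by positivity)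
  refine ((hasDerivAt_id v).div (hasDerivAt_sqrt_sq_add_sq hε v) h.ne').congr_deriv ?_
  simp only [id]
  field_simp
  rw [h2]
  ring

/-- Weighted `L¹` estimate: `|u|` is regularized to `√(u² + ε²)`, whose convexity absorbs the
advection term up to `O(ε)`, even though `b_x` is not assumed bounded. -/
theorem IsSolution.weighted_abs_le {b : ℝ → ℝ → ℝ} {u₀ : ℝ → ℝ} {u : ℝ → ℝ → ℝ}
    (hb : IsAdvectionField b) (hu : IsSolution b u₀ u) {C : ℝ}
    (hC : ∀ x t : ℝ, 0 ≤ t → |b x t| ≤ C) {R t₁ t₂ E : ℝ} (hR : 1 ≤ R) (ht₁ : 0 < t₁)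
    (ht : t₁ ≤ t₂) (hE : ∀ s ∈ Icc t₁ t₂, ∫ y in -R..R, |u y s| ≤ E) :
    ∫ y in -R..R, |u y t₂| * (1 - y ^ 2 / R ^ 2) ^ 2
      ≤ (∫ y in -R..R, |u y t₁| * (1 - y ^ 2 / R ^ 2) ^ 2)
        + (8 + 4 * C) / R * E * (t₂ - t₁) := by
  have hR0 : 0 < R := by linarith
  have hRR : -R ≤ R := by linarith
  have hC0 : 0 ≤ C := (abs_nonneg _).trans (hC 0 0 le_rfl)
  have hend : ∀ x : ℝ, x = -R ∨ x = R → 1 - x ^ 2 / R ^ 2 = 0 := by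
    rintro x (rfl | rfl) <;> field_simp <;> ring
  have key : ∀ ε : ℝ, 0 < ε → ∫ y in -R..R, |u y t₂| * (1 - y ^ 2 / R ^ 2) ^ 2
      ≤ (∫ y in -R..R, |u y t₁| * (1 - y ^ 2 / R ^ 2) ^ 2) + (8 + 4 * C) / R * E * (t₂ - t₁)
        + ε * ((8 / R + C ^ 2 / 4) * (2 * R) * (t₂ - t₁) + 2 * R) := by
    intro ε hε
    have hS0 : ∀ v : ℝ, 0 < √(v ^ 2 + ε ^ 2) := fun v => Real.sqrt_pos.2 (by positivity)
    have hS2 : ∀ v : ℝ, √(v ^ 2 + ε ^ 2) ^ 2 = v ^ 2 + ε ^ 2 := fun v =>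
      Real.sq_sqrt (by positivity)
    have hSabs : ∀ v : ℝ, |v| ≤ √(v ^ 2 + ε ^ 2) := fun v =>
      Real.abs_le_sqrt (by nlinarith)
    have hSε : ∀ v : ℝ, ε ≤ √(v ^ 2 + ε ^ 2) := fun v =>
      Real.le_sqrt_of_sq_le (by nlinarith [sq_nonneg v])
    have hSle : ∀ v : ℝ, √(v ^ 2 + ε ^ 2) ≤ |v| + ε := fun v => by
      rw [← sq_abs v]
      exact Real.sqrt_le_iff.2 ⟨by positivity, by nlinarith [abs_nonneg v]⟩
    have cS : Continuous fun v : ℝ => ε ^ 2 / √(v ^ 2 + ε ^ 2) ^ 3 :=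
      Continuous.div (by fun_prop) (by fun_prop) fun v => (pow_pos (hS0 v) 3).ne'
    have cS1 : Continuous fun v : ℝ => v / √(v ^ 2 + ε ^ 2) :=
      Continuous.div (by fun_prop) (by fun_prop) fun v => (hS0 v).ne'
    have hd : ∀ s ∈ Icc t₁ t₂, HasDerivAt
        (fun t => ∫ y in -R..R, √(u y t ^ 2 + ε ^ 2) * (1 - y ^ 2 / R ^ 2) ^ 2) _ s := fun s hs =>
      hu.hasDerivAt_integral_mul_weight hb (hasDerivAt_sqrt_sq_add_sq hε)
        (hasDerivAt_div_sqrt_sq_add_sq hε) cS isOpen_Ioi Subset.rfl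
        (ψ := fun y _ => (1 - y ^ 2 / R ^ 2) ^ 2) (ψs := fun _ _ => 0) (by fun_prop) (by fun_prop)
        (fun y t _ => hasDerivAt_const _ _) (ht₁.trans_le hs.1) (hasDerivAt_weight R)
        (hasDerivAt_weight_deriv R) (by fun_prop) (α := -R) (β := R)
        (by simp only [hend (-R) (Or.inl rfl)]; norm_num)
        (by simp only [hend R (Or.inr rfl)]; norm_num)
        (by simp only [hend (-R) (Or.inl rfl)]; norm_num)
        (by simp only [hend R (Or.inr rfl)]; norm_num) 0
    have hle := sub_le_mul_sub_of_hasDerivAt_le ht hd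
      (κ := (8 + 4 * C) / R * E + (8 / R + C ^ 2 / 4) * ε * (2 * R)) ?_
    · have h2 : ∫ y in -R..R, |u y t₂| * (1 - y ^ 2 / R ^ 2) ^ 2
          ≤ ∫ y in -R..R, √(u y t₂ ^ 2 + ε ^ 2) * (1 - y ^ 2 / R ^ 2) ^ 2 := by
        have := hu.continuous_space (ht₁.trans_le ht)
        refine intervalIntegral.integral_mono_on hRR
          (Continuous.intervalIntegrable (by fun_prop) _ _)
          (Continuous.intervalIntegrable (by fun_prop) _ _) fun y _ => ?_
        gcongr
        exact hSabs _
      have h1 : ∫ y in -R..R, √(u y t₁ ^ 2 + ε ^ 2) * (1 - y ^ 2 / R ^ 2) ^ 2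
          ≤ (∫ y in -R..R, |u y t₁| * (1 - y ^ 2 / R ^ 2) ^ 2) + ε * (2 * R) := by
        have := hu.continuous_space ht₁
        have e : ε * (2 * R) = ∫ _ in -R..R, ε := by
          rw [intervalIntegral.integral_const, smul_eq_mul]; ring
        rw [e, ← intervalIntegral.integral_add (Continuous.intervalIntegrable (by fun_prop) _ _)
          (Continuous.intervalIntegrable (by fun_prop) _ _)]
        refine intervalIntegral.integral_mono_on hRR
          (Continuous.intervalIntegrable (by fun_prop) _ _)
          (Continuous.intervalIntegrable (by fun_prop) _ _) fun y hy => ?_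
        have k1 := sq_div_sq_le_one hR0 hy
        have k2 : 0 ≤ y ^ 2 / R ^ 2 := by positivity
        have k3 : (1 - y ^ 2 / R ^ 2) ^ 2 ≤ 1 := pow_le_one₀ (by linarith) (by linarith)
        have k4 := mul_le_mul_of_nonneg_right (hSle (u y t₁)) (sq_nonneg (1 - y ^ 2 / R ^ 2))
        nlinarith
      linarith
    · intro s hs
      have hs0 := ht₁.trans_le hs.1
      have cus := hu.continuous_space hs0
      have cux : Continuous (deriv fun y => u y s) := (hu.contDiff_deriv_space hs0).continuous
      have cb := (hb.contDiff_space hs0.le).continuous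
      have cS' := cS.comp cus
      have cS1' := cS1.comp cus
      simp only [Function.comp_def] at cS' cS1'
      have hRC : 0 ≤ (8 + 4 * C) / R := by positivity
      calc _ ≤ ∫ y in -R..R, ((8 + 4 * C) / R * |u y s| + (8 / R + C ^ 2 / 4) * ε) := by
            refine intervalIntegral.integral_mono_on hRR
              (Continuous.intervalIntegrable (by fun_prop) _ _)
              (Continuous.intervalIntegrable (by fun_prop) _ _) fun y hy => ?_
            have k1 := abs_weight_deriv_le hR0 hy
            have k2 := abs_weight_deriv2_le hR hy
            have k3 := sq_div_sq_le_one hR0 hy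
            have k4 : 0 ≤ y ^ 2 / R ^ 2 := by positivity
            have k5 : (1 - y ^ 2 / R ^ 2) ^ 2 ≤ 1 := pow_le_one₀ (by linarith) (by linarith)
            set z1 := -(4 * y / R ^ 2 * (1 - y ^ 2 / R ^ 2))
            set z2 := -(4 / R ^ 2) + 12 * y ^ 2 / R ^ 4
            set ζ := (1 - y ^ 2 / R ^ 2) ^ 2
            have hζ0 : 0 ≤ ζ := sq_nonneg _
            have hbC := hC y s hs0.le
            set S := √(u y s ^ 2 + ε ^ 2) with hS
            have hSpos : 0 < S := hS0 _
            set ux := deriv (fun y => u y s) y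
            have e1 : S * z2 ≤ (|u y s| + ε) * (8 / R) :=
              (mul_le_mul_of_nonneg_left ((le_abs_self _).trans k2) hSpos.le).trans
                (mul_le_mul_of_nonneg_right (hSle _) (by positivity))
            have e2 : b y s * u y s * (u y s / S * z1) ≤ C * |u y s| * (1 * (4 / R)) := by
              refine (le_abs_self _).trans ?_
              rw [abs_mul, abs_mul, abs_mul, abs_div, abs_of_pos hSpos]
              have : |u y s| / S ≤ 1 := (div_le_one hSpos).2 (hSabs _)
              gcongr
            have e3 : ε ^ 2 / S ^ 3 * u y s ^ 2 ≤ ε := by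
              rw [div_mul_eq_mul_div, div_le_iff₀ (by positivity)]
              have h1 : u y s ^ 2 ≤ S ^ 2 := by rw [hS2]; nlinarith
              calc ε ^ 2 * u y s ^ 2 = ε * (ε * u y s ^ 2) := by ring
                _ ≤ ε * (S * S ^ 2) := by gcongr; exact hSε _
                _ = ε * S ^ 3 := by ring
            have e4 : b y s ^ 2 ≤ C ^ 2 := sq_le_sq.2 (by rwa [abs_of_nonneg hC0])
            have hΦ : 0 ≤ ε ^ 2 / S ^ 3 := by positivity
            set Φ := ε ^ 2 / S ^ 3
            have e5 : -(Φ * ux ^ 2 * ζ) + b y s * u y s * (Φ * ux * ζ) ≤ C ^ 2 / 4 * ε := by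
              calc -(Φ * ux ^ 2 * ζ) + b y s * u y s * (Φ * ux * ζ)
                  ≤ b y s ^ 2 / 4 * (Φ * u y s ^ 2) * ζ := by
                    nlinarith [mul_nonneg (mul_nonneg hΦ hζ0) (sq_nonneg (ux - b y s * u y s / 2))]
                _ ≤ C ^ 2 / 4 * ε * 1 := by gcongr
                _ = C ^ 2 / 4 * ε := mul_one _
            have e6 : (8 + 4 * C) / R * |u y s| + (8 / R + C ^ 2 / 4) * ε
                = (|u y s| + ε) * (8 / R) + C * |u y s| * (1 * (4 / R)) + C ^ 2 / 4 * ε := by ring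
            rw [e6]
            linarith
        _ = (8 + 4 * C) / R * (∫ y in -R..R, |u y s|)
              + (8 / R + C ^ 2 / 4) * ε * (2 * R) := by
            rw [intervalIntegral.integral_add, intervalIntegral.integral_const_mul,
              intervalIntegral.integral_const, smul_eq_mul]
            · ring
            all_goals exact Continuous.intervalIntegrable (by fun_prop) _ _
        _ ≤ _ := by gcongr; exact hE s hs
  refine le_of_forall_pos_le_add fun δ hδ => ?_
  set K := (8 / R + C ^ 2 / 4) * (2 * R) * (t₂ - t₁) + 2 * R with hK
  have hK0 : 0 < K := by
    have : 0 ≤ (8 / R + C ^ 2 / 4) * (2 * R) * (t₂ - t₁) :=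
      mul_nonneg (by positivity) (by linarith)
    linarith
  have := key (δ / K) (by positivity)
  rwa [div_mul_cancel₀ _ hK0.ne'] at this

/-- Letting `t₁ → 0` in the weighted estimate. -/
theorem IsSolution.weighted_abs_le_initial {b : ℝ → ℝ → ℝ} {u₀ : ℝ → ℝ} {u : ℝ → ℝ → ℝ}
    (hb : IsAdvectionField b) (hu : IsSolution b u₀ u) (hu₀ : MemLp u₀ 1 volume) {C : ℝ}
    (hC : ∀ x t : ℝ, 0 ≤ t → |b x t| ≤ C) {R t E : ℝ} (hR : 1 ≤ R) (ht : 0 < t) (hE0 : 0 ≤ E)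
    (hE : ∀ s ∈ Ioc 0 t, ∫ y in -R..R, |u y s| ≤ E) :
    ∫ y in -R..R, |u y t| * (1 - y ^ 2 / R ^ 2) ^ 2
      ≤ (eLpNorm u₀ 1 volume).toReal + (8 + 4 * C) / R * E * t := by
  have hR0 : 0 < R := by linarith
  have hRR : -R ≤ R := by linarith
  have hC0 : 0 ≤ C := (abs_nonneg _).trans (hC 0 0 le_rfl)
  refine le_of_forall_pos_le_add fun δ hδ => ?_
  have hlim := (hu.initial_lim (Icc (-R) R) isCompact_Icc).eventually
    (ge_mem_nhds (ENNReal.ofReal_pos.2 hδ))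
  obtain ⟨s, hs, hs0, hst⟩ := (hlim.and (Ioc_mem_nhdsGT ht)).exists
  have h1 := hu.weighted_abs_le hb hC hR hs0 hst fun τ hτ => hE τ ⟨hs0.trans_le hτ.1, hτ.2⟩
  have h2 : (8 + 4 * C) / R * E * (t - s) ≤ (8 + 4 * C) / R * E * t := by gcongr; linarith
  have cus := hu.continuous_space hs0
  have h3 : ∫ y in -R..R, |u y s| * (1 - y ^ 2 / R ^ 2) ^ 2
      ≤ (eLpNorm u₀ 1 volume).toReal + δ := by
    have h0 : ∫ y in -R..R, |u y s| * (1 - y ^ 2 / R ^ 2) ^ 2 ≤ ∫ y in -R..R, |u y s| := by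
      refine intervalIntegral.integral_mono_on hRR (Continuous.intervalIntegrable (by fun_prop) _ _)
        (Continuous.intervalIntegrable (by fun_prop) _ _) fun y hy => ?_
      have k3 := sq_div_sq_le_one hR0 hy
      have k4 : 0 ≤ y ^ 2 / R ^ 2 := by positivity
      exact mul_le_of_le_one_right (abs_nonneg _) (pow_le_one₀ (by linarith) (by linarith))
    refine h0.trans ?_
    have hfin : eLpNorm u₀ 1 volume ≠ ⊤ := hu₀.eLpNorm_ne_top
    rw [← ENNReal.ofReal_le_ofReal_iff (by positivity), ENNReal.ofReal_add (by positivity) hδ.le,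
      ENNReal.ofReal_toReal hfin, intervalIntegral.integral_of_le hRR,
      ofReal_integral_eq_lintegral_ofReal
        ((cus.abs.integrableOn_Icc).mono_set Ioc_subset_Icc_self)
        (Eventually.of_forall fun _ => abs_nonneg _), eLpNorm_one_eq_lintegral_enorm]
    calc ∫⁻ y in Ioc (-R) R, ENNReal.ofReal |u y s|
        ≤ ∫⁻ y in Icc (-R) R, (‖u₀ y‖ₑ + ‖u y s - u₀ y‖ₑ) := by
          refine (lintegral_mono fun y => ?_).trans (lintegral_mono_set Ioc_subset_Icc_self)
          rw [← Real.enorm_eq_ofReal_abs]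
          simpa using enorm_add_le (u₀ y) (u y s - u₀ y)
      _ = (∫⁻ y in Icc (-R) R, ‖u₀ y‖ₑ) + ∫⁻ y in Icc (-R) R, ‖u y s - u₀ y‖ₑ :=
          lintegral_add_left' hu₀.aestronglyMeasurable.enorm.restrict _
      _ ≤ _ := add_le_add (setLIntegral_le_lintegral _ _) hs
  linarith

/-- The `L¹` norm never exceeds its initial value. The weighted estimate is used twice: with the
trivial bound `2 R M` for `∫ |u|` on `[-R, R]` it shows that the `L¹` norm is locally bounded in
time, and then the error term is `O(1 / R)`. -/
theorem IsSolution.lintegral_abs_le {b : ℝ → ℝ → ℝ} {u₀ : ℝ → ℝ} {u : ℝ → ℝ → ℝ}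
    (hb : IsAdvectionField b) (hu : IsSolution b u₀ u) (hu₀ : MemLp u₀ 1 volume) {t : ℝ}
    (ht : 0 < t) :
    ∫⁻ x, ENNReal.ofReal |u x t| ≤ eLpNorm u₀ 1 volume := by
  obtain ⟨C, hC⟩ := hb.bounded
  have hC0 : 0 ≤ C := (abs_nonneg _).trans (hC 0 0 le_rfl)
  obtain ⟨M, hM⟩ := hu.bounded_strip t ht
  have hM0 : 0 ≤ M := (abs_nonneg _).trans (hM 0 0 le_rfl ht.le)
  set A := (eLpNorm u₀ 1 volume).toReal with hA
  have hA0 : 0 ≤ A := ENNReal.toReal_nonneg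
  have hfin : eLpNorm u₀ 1 volume ≠ ⊤ := hu₀.eLpNorm_ne_top
  have h1 : ∀ s ∈ Ioc 0 t, ∀ R : ℝ, 0 ≤ R → ∫ y in -R..R, |u y s| ≤ M * (2 * R) := by
    intro s hs R hR
    have e : M * (2 * R) = ∫ _ in -R..R, M := by
      rw [intervalIntegral.integral_const, smul_eq_mul]; ring
    rw [e]
    exact intervalIntegral.integral_mono_on (by linarith)
      ((hu.continuous_space hs.1).abs.intervalIntegrable _ _) intervalIntegrable_const
      fun y _ => hM y s hs.1.le hs.2
  set l := A + (8 + 4 * C) * (M * 2) * t with hl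
  have hl0 : 0 ≤ l := by positivity
  have h2 : ∀ s ∈ Ioc 0 t, ∫⁻ x, ENNReal.ofReal |u x s| ≤ ENNReal.ofReal l := by
    intro s hs
    refine lintegral_le_of_weighted_le (hu.continuous_space hs.1).abs (fun _ => abs_nonneg _) ?_
    filter_upwards [eventually_ge_atTop 1] with R hR
    have hR0 : 0 < R := by linarith
    refine (hu.weighted_abs_le_initial hb hu₀ hC hR hs.1 (by positivity)
      fun τ hτ => h1 τ ⟨hτ.1, hτ.2.trans hs.2⟩ R hR0.le).trans ?_
    have e : (8 + 4 * C) / R * (M * (2 * R)) * s = (8 + 4 * C) * (M * 2) * s := by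
      field_simp
    rw [e, hl]
    gcongr
    exact hs.2
  have h3 : ∀ δ : ℝ, 0 < δ → ∫⁻ x, ENNReal.ofReal |u x t| ≤ ENNReal.ofReal (A + δ) := by
    intro δ hδ
    refine lintegral_le_of_weighted_le (hu.continuous_space ht).abs (fun _ => abs_nonneg _) ?_
    have hlim : Tendsto (fun R : ℝ => (8 + 4 * C) * l * t / R) atTop (𝓝 0) :=
      tendsto_const_nhds.div_atTop tendsto_id
    filter_upwards [eventually_ge_atTop 1, hlim.eventually (ge_mem_nhds hδ)] with R hR hRδ
    refine (hu.weighted_abs_le_initial hb hu₀ hC hR ht hl0 fun τ hτ =>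
      intervalIntegral_le_of_lintegral_le (hu.continuous_space hτ.1).abs (fun _ => abs_nonneg _)
        hl0 (h2 τ hτ) (by linarith)).trans ?_
    have e : (8 + 4 * C) / R * l * t = (8 + 4 * C) * l * t / R := by ring
    rw [e]
    gcongr
  rw [← ENNReal.ofReal_toReal hfin]
  refine ENNReal.le_of_forall_pos_le_add fun δ hδ _ => ?_
  have := h3 δ (by exact_mod_cast hδ)
  rwa [ENNReal.ofReal_add hA0 δ.coe_nonneg, ENNReal.ofReal_coe_nnreal] at this

/-! ### From `L^q` to `L^∞` by the heat kernel -/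

/-- The heat kernel `exp (-z² / (4σ)) / √(4πσ)` at time `σ > 0`. -/
noncomputable def heatKernel (σ z : ℝ) : ℝ :=
  Real.exp (-z ^ 2 / (4 * σ)) / √(4 * Real.pi * σ)

theorem heatKernel_nonneg (σ z : ℝ) : 0 ≤ heatKernel σ z := by
  unfold heatKernel; positivity

theorem heatKernel_le {σ : ℝ} (hσ : 0 < σ) (z : ℝ) :
    2 * heatKernel σ z ≤ 1 / √σ := by
  have h1 : Real.exp (-z ^ 2 / (4 * σ)) ≤ 1 := by
    rw [Real.exp_le_one_iff]
    exact div_nonpos_of_nonpos_of_nonneg (by nlinarith [sq_nonneg z]) (by positivity)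
  have h2 : 2 * √σ ≤ √(4 * Real.pi * σ) := by
    refine Real.le_sqrt_of_sq_le ?_
    rw [mul_pow, Real.sq_sqrt hσ.le]
    nlinarith [Real.pi_gt_three]
  have hs := Real.sqrt_pos.2 hσ
  unfold heatKernel
  rw [← mul_div_assoc, div_le_div_iff₀ (by positivity) hs]
  nlinarith

theorem hasDerivAt_heatKernel_space {σ : ℝ} (hσ : 0 < σ) (z : ℝ) :
    HasDerivAt (heatKernel σ) (-(z / (2 * σ)) * heatKernel σ z) z := by
  have h := ((((hasDerivAt_pow 2 z).neg).div_const (4 * σ)).exp).div_const (√(4 * Real.pi * σ))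
  refine h.congr_deriv ?_
  simp only [heatKernel, Pi.neg_apply]
  push_cast
  field_simp
  ring

theorem hasDerivAt_heatKernel_space2 {σ : ℝ} (hσ : 0 < σ) (z : ℝ) :
    HasDerivAt (fun z => -(z / (2 * σ)) * heatKernel σ z)
      ((z ^ 2 / (4 * σ ^ 2) - 1 / (2 * σ)) * heatKernel σ z) z := by
  refine ((((hasDerivAt_id z).div_const (2 * σ)).neg).mul
    (hasDerivAt_heatKernel_space hσ z)).congr_deriv ?_
  simp only [id, Pi.neg_apply]
  field_simp
  ring

theorem hasDerivAt_heatKernel_time {σ : ℝ} (hσ : 0 < σ) (z : ℝ) :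
    HasDerivAt (fun σ => heatKernel σ z)
      ((z ^ 2 / (4 * σ ^ 2) - 1 / (2 * σ)) * heatKernel σ z) σ := by
  have h0 : 4 * Real.pi * σ ≠ 0 := by positivity
  have hs : 0 < √(4 * Real.pi * σ) := Real.sqrt_pos.2 (by positivity)
  have hs2 : √(4 * Real.pi * σ) ^ 2 = 4 * Real.pi * σ := Real.sq_sqrt (by positivity)
  have h1 : HasDerivAt (fun σ : ℝ => -z ^ 2 / (4 * σ)) (z ^ 2 / (4 * σ ^ 2)) σ := by
    refine ((hasDerivAt_const σ (-z ^ 2)).div ((hasDerivAt_id σ).const_mul 4)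
      (by simpa using hσ.ne')).congr_deriv ?_
    simp only [id]
    field_simp
    ring
  have h2 : HasDerivAt (fun σ : ℝ => √(4 * Real.pi * σ))
      (4 * Real.pi / (2 * √(4 * Real.pi * σ))) σ :=
    (((hasDerivAt_id σ).const_mul (4 * Real.pi)).sqrt h0).congr_deriv (by simp)
  refine (h1.exp.div h2 hs.ne').congr_deriv ?_
  simp only [heatKernel]
  rw [hs2]
  field_simp
  rw [Real.sq_sqrt (by positivity)]
  ring

theorem continuousOn_heatKernel :
    ContinuousOn (fun z : ℝ × ℝ => heatKernel z.1 z.2) (Ioi 0 ×ˢ univ) := by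
  unfold heatKernel
  refine ContinuousOn.div ?_ (by fun_prop) fun z hz => ?_
  · refine Real.continuous_exp.comp_continuousOn (ContinuousOn.div (by fun_prop) (by fun_prop) ?_)
    intro z hz
    have : 0 < z.1 := hz.1
    positivity
  · have : 0 < z.1 := hz.1
    positivity

theorem continuous_heatKernel {σ : ℝ} (hσ : 0 < σ) : Continuous (heatKernel σ) :=
  continuous_iff_continuousAt.2 fun z => (hasDerivAt_heatKernel_space hσ z).continuousAt

theorem heatKernel_eq (σ z : ℝ) :
    heatKernel σ z = Real.exp (-(1 / (4 * σ)) * z ^ 2) / √(4 * Real.pi * σ) := by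
  unfold heatKernel; congr 2; ring

theorem integrable_heatKernel {σ : ℝ} (hσ : 0 < σ) : Integrable (heatKernel σ) := by
  have h := (integrable_exp_neg_mul_sq (b := 1 / (4 * σ)) (by positivity)).div_const
    (√(4 * Real.pi * σ))
  exact h.congr (Eventually.of_forall fun z => (heatKernel_eq σ z).symm)

theorem integral_heatKernel {σ : ℝ} (hσ : 0 < σ) : ∫ z, heatKernel σ z = 1 := by
  simp only [heatKernel_eq]
  rw [integral_div, integral_gaussian]
  have e : Real.pi / (1 / (4 * σ)) = 4 * Real.pi * σ := by field_simp
  rw [e]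
  exact div_self (Real.sqrt_pos.2 (by positivity)).ne'

theorem intervalIntegral_heatKernel_le {σ : ℝ} (hσ : 0 < σ) :
    ∫ z in (-1 : ℝ)..1, heatKernel σ z ≤ 1 := by
  rw [intervalIntegral.integral_of_le (by norm_num), ← integral_heatKernel hσ]
  exact setIntegral_le_integral (integrable_heatKernel hσ)
    (Eventually.of_forall (heatKernel_nonneg σ))

theorem intervalIntegral_abs_heatKernel_deriv_le {σ : ℝ} (hσ : 0 < σ) :
    ∫ z in (-1 : ℝ)..1, |-(z / (2 * σ)) * heatKernel σ z| ≤ 1 / √σ := by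
  have c := continuous_heatKernel hσ
  have hF : ∀ a b, ∫ z in a..b, -(z / (2 * σ)) * heatKernel σ z
      = heatKernel σ b - heatKernel σ a := fun a b =>
    intervalIntegral.integral_eq_sub_of_hasDerivAt (fun z _ => hasDerivAt_heatKernel_space hσ z)
      (Continuous.intervalIntegrable (by fun_prop) _ _)
  have h1 : ∫ z in (-1 : ℝ)..0, |-(z / (2 * σ)) * heatKernel σ z|
      = heatKernel σ 0 - heatKernel σ (-1) := by
    rw [← hF]
    refine intervalIntegral.integral_congr fun z hz => abs_of_nonneg ?_
    rw [uIcc_of_le (by norm_num)] at hz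
    refine mul_nonneg ?_ (heatKernel_nonneg _ _)
    rw [← neg_div]
    exact div_nonneg (by linarith [hz.2]) (by positivity)
  have h2 : ∫ z in (0 : ℝ)..1, |-(z / (2 * σ)) * heatKernel σ z|
      = -(heatKernel σ 1 - heatKernel σ 0) := by
    rw [← hF, ← intervalIntegral.integral_neg]
    refine intervalIntegral.integral_congr fun z hz => abs_of_nonpos ?_
    rw [uIcc_of_le (by norm_num)] at hz
    refine mul_nonpos_of_nonpos_of_nonneg ?_ (heatKernel_nonneg _ _)
    rw [← neg_div]
    exact div_nonpos_of_nonpos_of_nonneg (by linarith [hz.1]) (by positivity)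
  rw [← intervalIntegral.integral_add_adjacent_intervals (b := 0)
    (Continuous.intervalIntegrable (by fun_prop) _ _)
    (Continuous.intervalIntegrable (by fun_prop) _ _), h1, h2]
  have := heatKernel_le hσ 0
  have := heatKernel_nonneg σ 1
  have := heatKernel_nonneg σ (-1)
  linarith

/-- The heat kernel is an approximate identity. -/
theorem tendsto_integral_heatKernel_mul {f : ℝ → ℝ} (hf : Continuous f) :
    Tendsto (fun c : ℝ => ∫ z in (-1 : ℝ)..1, f z * heatKernel (1 / c ^ 2) z) atTop (𝓝 (f 0)) := by
  have hg : Integrable ((Ioc (-1 : ℝ) 1).indicator f) :=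
    (integrable_indicator_iff measurableSet_Ioc).2
      (hf.integrableOn_Icc.mono_set Ioc_subset_Icc_self)
  have hg0 : ContinuousAt ((Ioc (-1 : ℝ) 1).indicator f) 0 := by
    refine hf.continuousAt.congr ?_
    filter_upwards [Ioc_mem_nhds (by norm_num : (-1 : ℝ) < 0) one_pos] with z hz
    rw [indicator_of_mem hz]
  have hdecay : Tendsto (fun x : ℝ => ‖x‖ ^ Module.finrank ℝ ℝ * heatKernel 1 x)
      (Bornology.cobounded ℝ) (𝓝 0) := by
    rw [Module.finrank_self]
    have h1 := tendsto_rpow_abs_mul_exp_neg_mul_sq_cocompact (a := 1 / 4) (by norm_num) 1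
    rw [← Metric.cobounded_eq_cocompact] at h1
    have h2 := h1.div_const (√(4 * Real.pi * 1))
    rw [zero_div] at h2
    refine h2.congr fun x => ?_
    rw [heatKernel_eq, Real.rpow_one, pow_one, Real.norm_eq_abs, mul_one, mul_one,
      mul_div_assoc]
  have h := tendsto_integral_comp_smul_smul_of_integrable (μ := volume) (heatKernel_nonneg 1)
    (integral_heatKernel one_pos) hdecay hg hg0
  rw [indicator_of_mem (by norm_num : (0 : ℝ) ∈ Ioc (-1 : ℝ) 1)] at h
  refine h.congr' ?_
  filter_upwards [eventually_gt_atTop 0] with c hc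
  rw [intervalIntegral.integral_of_le (by norm_num), ← integral_indicator measurableSet_Ioc]
  refine integral_congr_ae (Eventually.of_forall fun z => ?_)
  simp only [indicator, smul_eq_mul, Module.finrank_self, pow_one]
  split_ifs
  · have e : √(4 * Real.pi * (1 / c ^ 2)) = √(4 * Real.pi) / c := by
      rw [mul_one_div, Real.sqrt_div (by positivity), Real.sqrt_sq hc.le]
    have hpi : 0 < √(4 * Real.pi) := Real.sqrt_pos.2 (by positivity)
    rw [heatKernel_eq, heatKernel_eq, e, mul_one]
    have e2 : -(1 / (4 * (1 / c ^ 2))) * z ^ 2 = -(1 / 4) * (c * z) ^ 2 := by field_simp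
    rw [e2]
    field_simp
  · simp

theorem hasDerivAt_cutoff (x y : ℝ) : HasDerivAt (fun y : ℝ => (1 - (y - x) ^ 2) ^ 2)
    (-(4 * (y - x) * (1 - (y - x) ^ 2))) y := by
  have := ((((hasDerivAt_id y).sub_const x).pow 2).const_sub 1).pow 2
  refine this.congr_deriv ?_
  simp only [id, Pi.pow_apply]
  push_cast
  ring

theorem hasDerivAt_cutoff_deriv (x y : ℝ) :
    HasDerivAt (fun y : ℝ => -(4 * (y - x) * (1 - (y - x) ^ 2)))
    (-4 + 12 * (y - x) ^ 2) y := by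
  have := ((((hasDerivAt_id y).sub_const x).const_mul 4).mul
    ((((hasDerivAt_id y).sub_const x).pow 2).const_sub 1)).neg
  refine this.congr_deriv ?_
  simp only [id, Pi.pow_apply]
  push_cast
  ring

/-- The rate of change of `∫ u ψ`, where `ψ` is the backward heat kernel around `x` with pole at
time `τ`, cut off at distance `1` from `x`. -/
theorem IsSolution.exists_hasDerivAt_integral_mul_heatKernel {b : ℝ → ℝ → ℝ} {u₀ : ℝ → ℝ}
    {u : ℝ → ℝ → ℝ} (hb : IsAdvectionField b) (hu : IsSolution b u₀ u) {C : ℝ}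
    (hC : ∀ x t : ℝ, 0 ≤ t → |b x t| ≤ C) (x : ℝ) {τ s M : ℝ} (hs : 0 < s) (hsτ : s < τ)
    (hM : ∀ y, |u y s| ≤ M) :
    ∃ J' : ℝ, HasDerivAt (fun t => ∫ y in x - 1..x + 1,
        u y t * (heatKernel (τ - t) (y - x) * (1 - (y - x) ^ 2) ^ 2)) J' s ∧
      |J'| ≤ (8 + 4 * C) * M * (1 / √(τ - s) + 1) := by
  have hC0 : 0 ≤ C := (abs_nonneg _).trans (hC 0 0 le_rfl)
  have hM0 : 0 ≤ M := (abs_nonneg _).trans (hM 0)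
  have hσ : 0 < τ - s := by linarith
  have hOc : ContinuousOn (fun z : ℝ × ℝ => heatKernel (τ - z.2) (z.1 - x))
      (univ ×ˢ Ioo 0 τ) :=
    continuousOn_heatKernel.comp (f := fun z : ℝ × ℝ => (τ - z.2, z.1 - x)) (by fun_prop)
      fun z hz => ⟨by have := hz.2.2; simp only [mem_Ioi]; linarith, mem_univ _⟩
  have hkd : ∀ z : ℝ × ℝ, z ∈ (univ : Set ℝ) ×ˢ Ioo 0 τ → τ - z.2 ≠ 0 := fun z hz => by
    have := hz.2.2
    linarith
  have d1 : ∀ y, HasDerivAt (fun y => heatKernel (τ - s) (y - x))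
      (-((y - x) / (2 * (τ - s))) * heatKernel (τ - s) (y - x)) y := fun y =>
    (hasDerivAt_heatKernel_space hσ (y - x)).comp_sub_const y x
  have d2 : ∀ y, HasDerivAt (fun y => -((y - x) / (2 * (τ - s))) * heatKernel (τ - s) (y - x))
      (((y - x) ^ 2 / (4 * (τ - s) ^ 2) - 1 / (2 * (τ - s))) * heatKernel (τ - s) (y - x)) y :=
    fun y => (hasDerivAt_heatKernel_space2 hσ (y - x)).comp_sub_const y x
  have cG : Continuous fun y => heatKernel (τ - s) (y - x) :=
    (continuous_heatKernel hσ).comp (by fun_prop)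
  have key := hu.hasDerivAt_integral_mul_weight hb (φ := fun v => v) (φ' := fun _ => 1)
    (φ'' := fun _ => 0) (fun v => hasDerivAt_id' v) (fun v => hasDerivAt_const _ _) continuous_const
    (O := Ioo 0 τ) isOpen_Ioo Ioo_subset_Ioi_self
    (ψ := fun y t => heatKernel (τ - t) (y - x) * (1 - (y - x) ^ 2) ^ 2)
    (ψs := fun y t => -((((y - x) ^ 2 / (4 * (τ - t) ^ 2) - 1 / (2 * (τ - t)))
      * heatKernel (τ - t) (y - x))) * (1 - (y - x) ^ 2) ^ 2)
    (ψy := fun y => -((y - x) / (2 * (τ - s))) * heatKernel (τ - s) (y - x) * (1 - (y - x) ^ 2) ^ 2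
      + heatKernel (τ - s) (y - x) * -(4 * (y - x) * (1 - (y - x) ^ 2)))
    (hOc.mul (by fun_prop))
    (((ContinuousOn.mul (ContinuousOn.sub (ContinuousOn.div (by fun_prop) (by fun_prop)
      fun z hz => by have := hkd z hz; positivity) (ContinuousOn.div (by fun_prop) (by fun_prop)
      fun z hz => by have := hkd z hz; positivity)) hOc).neg).mul (by fun_prop))
    (fun y t ht => by
      have h := ((hasDerivAt_heatKernel_time (by linarith [ht.2] : 0 < τ - t) (y - x)).comp t
        ((hasDerivAt_id t).const_sub τ)).mul_const ((1 - (y - x) ^ 2) ^ 2)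
      refine h.congr_deriv ?_
      ring)
    (s := s) ⟨hs, hsτ⟩ (fun y => (d1 y).mul (hasDerivAt_cutoff x y))
    (fun y => ((d2 y).mul (hasDerivAt_cutoff x y)).add ((d1 y).mul (hasDerivAt_cutoff_deriv x y)))
    (by fun_prop) (α := x - 1) (β := x + 1) (by norm_num) (by norm_num) (by norm_num)
    (by norm_num) 0
  refine ⟨_, key, ?_⟩
  have hle1 : x - 1 ≤ x + 1 := by linarith
  rw [← Real.norm_eq_abs]
  refine (intervalIntegral.norm_integral_le_of_norm_le (μ := volume) hle1
    (g := fun y => (8 + 4 * C) * M * (|-((y - x) / (2 * (τ - s))) * heatKernel (τ - s) (y - x)|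
      + heatKernel (τ - s) (y - x))) (Eventually.of_forall fun y hy => ?_)
    (Continuous.intervalIntegrable (by fun_prop) _ _)).trans ?_
  rotate_left
  · rw [intervalIntegral.integral_const_mul]
    gcongr
    rw [intervalIntegral.integral_add (Continuous.intervalIntegrable (by fun_prop) _ _)
      (Continuous.intervalIntegrable (by fun_prop) _ _)]
    have e1 := intervalIntegral.integral_comp_sub_right (a := x - 1) (b := x + 1)
      (fun z => |-(z / (2 * (τ - s))) * heatKernel (τ - s) z|) x
    have e2 := intervalIntegral.integral_comp_sub_right (a := x - 1) (b := x + 1)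
      (fun z => heatKernel (τ - s) z) x
    have e3 : x - 1 - x = -1 := by ring
    have e4 : x + 1 - x = 1 := by ring
    rw [e1, e2, e3, e4]
    exact add_le_add (intervalIntegral_abs_heatKernel_deriv_le hσ)
      (intervalIntegral_heatKernel_le hσ)
  · have hG0 := heatKernel_nonneg (τ - s) (y - x)
    have hz : |y - x| ≤ 1 := abs_le.2 ⟨by linarith [hy.1], by linarith [hy.2]⟩
    have hz2 : (y - x) ^ 2 ≤ 1 := by rw [← sq_abs]; exact pow_le_one₀ (abs_nonneg _) hz
    have hz0 := sq_nonneg (y - x)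
    set G := heatKernel (τ - s) (y - x)
    set Gz := -((y - x) / (2 * (τ - s))) * G
    have hζ1 : |-(4 * (y - x) * (1 - (y - x) ^ 2))| ≤ 4 := by
      rw [abs_neg, abs_mul, abs_mul, abs_of_nonneg (by linarith : 0 ≤ 1 - (y - x) ^ 2)]
      calc |(4 : ℝ)| * |y - x| * (1 - (y - x) ^ 2) ≤ 4 * 1 * 1 := by
            gcongr
            · norm_num
            · linarith
        _ = 4 := by norm_num
    have hζ2 : |-4 + 12 * (y - x) ^ 2| ≤ 8 := by rw [abs_le]; constructor <;> linarith
    have hζ0 : |(1 - (y - x) ^ 2) ^ 2| ≤ 1 := by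
      rw [abs_of_nonneg (sq_nonneg _)]; exact pow_le_one₀ (by linarith) (by linarith)
    set ζ := (1 - (y - x) ^ 2) ^ 2
    set ζ1 := -(4 * (y - x) * (1 - (y - x) ^ 2))
    set ζ2 := -4 + 12 * (y - x) ^ 2
    have a1 : |2 * (Gz * ζ1) + G * ζ2| ≤ 2 * (|Gz| * 4) + G * 8 := by
      refine (abs_add_le _ _).trans ?_
      rw [abs_mul 2, abs_mul Gz, abs_mul G, abs_of_nonneg hG0,
        abs_of_pos (by norm_num : (0 : ℝ) < 2)]
      gcongr
    have a2 : |Gz * ζ + G * ζ1| ≤ |Gz| * 1 + G * 4 := by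
      refine (abs_add_le _ _).trans ?_
      rw [abs_mul Gz, abs_mul G, abs_of_nonneg hG0]
      gcongr
    have a3 : |b y s * u y s| ≤ C * M := by
      rw [abs_mul]
      exact mul_le_mul (hC y s hs.le) (hM y) (abs_nonneg _) hC0
    rw [Real.norm_eq_abs]
    calc _ = |u y s * (2 * (Gz * ζ1) + G * ζ2) + b y s * u y s * (Gz * ζ + G * ζ1)| := by
          congr 1; ring
      _ ≤ M * (2 * (|Gz| * 4) + G * 8) + C * M * (|Gz| * 1 + G * 4) := by
          refine (abs_add_le _ _).trans (add_le_add ?_ ?_)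
          · rw [abs_mul]
            exact mul_le_mul (hM y) a1 (abs_nonneg _) hM0
          · rw [abs_mul]
            exact mul_le_mul a3 a2 (abs_nonneg _) (by positivity)
      _ ≤ (8 + 4 * C) * M * (|Gz| + G) := by
          have : 0 ≤ C * M * |Gz| := by positivity
          nlinarith

/-- A bound for `u` at time `t + h` in terms of its `L^q` norm at time `t`. The duality with the
heat kernel only uses the bound `|u| ≤ A + A |u|^q / A^q`, so that large `q` cost nothing as soon
as `∫ |u|^q` is much smaller than `A^q`. -/
theorem IsSolution.abs_le_of_lintegral_le {b : ℝ → ℝ → ℝ} {u₀ : ℝ → ℝ} {u : ℝ → ℝ → ℝ}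
    (hb : IsAdvectionField b) (hu : IsSolution b u₀ u) {C : ℝ}
    (hC : ∀ x t : ℝ, 0 ≤ t → |b x t| ≤ C) {t h q N A M : ℝ} (ht : 0 < t) (hh : 0 < h)
    (hq : 1 ≤ q) (hN : 0 ≤ N) (hA : 0 < A)
    (hLq : ∫⁻ x, ENNReal.ofReal (|u x t| ^ q) ≤ ENNReal.ofReal N)
    (hM : ∀ y, ∀ s ∈ Icc t (t + h), |u y s| ≤ M) (x : ℝ) :
    |u x (t + h)| ≤ A + A * (N / A ^ q) / √h + (8 + 4 * C) * M * (2 * √h + h) := by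
  have hC0 : 0 ≤ C := (abs_nonneg _).trans (hC 0 0 le_rfl)
  have hM0 : 0 ≤ M := (abs_nonneg _).trans (hM 0 t ⟨le_rfl, by linarith⟩)
  have hK0 : 0 ≤ (8 + 4 * C) * M := by positivity
  have hAq : 0 < A ^ q := Real.rpow_pos_of_pos hA q
  have hth : t ≤ t + h := by linarith
  have hle1 : x - 1 ≤ x + 1 := by linarith
  have hsplit : ∀ v : ℝ, |v| ≤ A + A / A ^ q * |v| ^ q := by
    intro v
    have hnn : 0 ≤ A / A ^ q * |v| ^ q := by positivity
    rcases le_or_gt |v| A with hv | hv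
    · linarith
    · have h1 : A ^ (q - 1) ≤ |v| ^ (q - 1) := Real.rpow_le_rpow hA.le hv.le (by linarith)
      have h2 : |v| ^ q = |v| ^ (q - 1) * |v| := by
        rw [← Real.rpow_add_one (hA.trans hv).ne', sub_add_cancel]
      have h3 : A ^ q = A ^ (q - 1) * A := by
        rw [← Real.rpow_add_one hA.ne', sub_add_cancel]
      have h4 : 0 < A ^ (q - 1) := Real.rpow_pos_of_pos hA _
      have h5 : |v| ≤ A / A ^ q * |v| ^ q := by
        rw [h2, h3, div_mul_eq_mul_div, le_div_iff₀ (by positivity)]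
        have : 0 ≤ A * |v| := by positivity
        nlinarith
      linarith
  -- the pole of the kernel is placed at time `t + h + σ₀`, which keeps it smooth up to `t + h`
  have hbound : ∀ σ₀ : ℝ, 0 < σ₀ →
      |∫ y in x - 1..x + 1, u y (t + h) * (heatKernel σ₀ (y - x) * (1 - (y - x) ^ 2) ^ 2)|
        ≤ A + A * (N / A ^ q) / √h + (8 + 4 * C) * M * (2 * √(h + σ₀) + h) := by
    intro σ₀ hσ₀
    set τ := t + h + σ₀ with hτ
    set J : ℝ → ℝ := fun s => ∫ y in x - 1..x + 1,
      u y s * (heatKernel (τ - s) (y - x) * (1 - (y - x) ^ 2) ^ 2) with hJ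
    have hJT : J (t + h) = ∫ y in x - 1..x + 1,
        u y (t + h) * (heatKernel σ₀ (y - x) * (1 - (y - x) ^ 2) ^ 2) := by
      simp only [hJ, hτ, add_sub_cancel_left]
    choose! J' hJ' hJ'le using fun (s : ℝ) (hs : s ∈ Icc t (t + h)) =>
      hu.exists_hasDerivAt_integral_mul_heatKernel hb hC x (τ := τ) (ht.trans_le hs.1)
        (by linarith [hs.2]) fun y => hM y s hs
    -- an antiderivative of the bound for `|J'|`
    set B : ℝ → ℝ := fun s => (8 + 4 * C) * M * (s - 2 * √(τ - s)) with hB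
    have hBd : ∀ s ∈ Icc t (t + h),
        HasDerivAt B ((8 + 4 * C) * M * (1 / √(τ - s) + 1)) s := by
      intro s hs
      have hpos : 0 < τ - s := by linarith [hs.2]
      have hsq := Real.sqrt_pos.2 hpos
      have := (((hasDerivAt_id s).const_sub τ).sqrt hpos.ne').const_mul 2
      refine (((hasDerivAt_id s).sub this).const_mul ((8 + 4 * C) * M)).congr_deriv ?_
      simp only [id]
      field_simp
      ring
    have up := sub_le_mul_sub_of_hasDerivAt_le (κ := 0) hth
      (fun s hs => (hJ' s hs).sub (hBd s hs))
      (fun s hs => by linarith [(abs_le.1 (hJ'le s hs)).2])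
    have lo := sub_le_mul_sub_of_hasDerivAt_le (κ := 0) hth
      (fun s hs => ((hJ' s hs).neg).sub (hBd s hs))
      (fun s hs => by linarith [(abs_le.1 (hJ'le s hs)).1])
    simp only [Pi.sub_apply, Pi.neg_apply, zero_mul] at up lo
    have hBle : B (t + h) - B t ≤ (8 + 4 * C) * M * (2 * √(h + σ₀) + h) := by
      have e1 : τ - (t + h) = σ₀ := by rw [hτ]; ring
      have e2 : τ - t = h + σ₀ := by rw [hτ]; ring
      simp only [hB]
      rw [e1, e2, ← mul_sub]
      refine mul_le_mul_of_nonneg_left ?_ hK0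
      linarith [Real.sqrt_nonneg σ₀]
    have hJt : |J t| ≤ A + A * (N / A ^ q) / √h := by
      have hσ : 0 < h + σ₀ := by linarith
      have e2 : τ - t = h + σ₀ := by rw [hτ]; ring
      have cut := hu.continuous_space ht
      have cG : Continuous fun y => heatKernel (h + σ₀) (y - x) :=
        (continuous_heatKernel hσ).comp (by fun_prop)
      have cq : Continuous fun y => |u y t| ^ q :=
        (continuous_abs_rpow (by linarith)).comp cut
      have hGle : ∀ z, heatKernel (h + σ₀) z ≤ 1 / √h := by
        intro z
        have h1 := heatKernel_le hσ z
        have h2 := heatKernel_nonneg (h + σ₀) z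
        have h3 : 1 / √(h + σ₀) ≤ 1 / √h :=
          one_div_le_one_div_of_le (Real.sqrt_pos.2 hh) (Real.sqrt_le_sqrt (by linarith))
        linarith
      simp only [hJ]
      rw [e2, ← Real.norm_eq_abs]
      refine (intervalIntegral.norm_integral_le_of_norm_le (μ := volume) hle1
        (g := fun y => A * heatKernel (h + σ₀) (y - x) + A / A ^ q * (1 / √h) * |u y t| ^ q)
        (Eventually.of_forall fun y hy => ?_)
        (Continuous.intervalIntegrable (by fun_prop) _ _)).trans ?_
      · have hz : |y - x| ≤ 1 := abs_le.2 ⟨by linarith [hy.1], by linarith [hy.2]⟩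
        have hz2 : (y - x) ^ 2 ≤ 1 := by rw [← sq_abs]; exact pow_le_one₀ (abs_nonneg _) hz
        have hz0 := sq_nonneg (y - x)
        have hζ : (1 - (y - x) ^ 2) ^ 2 ≤ 1 := pow_le_one₀ (by linarith) (by linarith)
        have hG0 := heatKernel_nonneg (h + σ₀) (y - x)
        have habs : |heatKernel (h + σ₀) (y - x) * (1 - (y - x) ^ 2) ^ 2|
            = heatKernel (h + σ₀) (y - x) * (1 - (y - x) ^ 2) ^ 2 :=
          abs_of_nonneg (mul_nonneg hG0 (sq_nonneg _))
        rw [Real.norm_eq_abs, abs_mul, habs]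
        calc |u y t| * (heatKernel (h + σ₀) (y - x) * (1 - (y - x) ^ 2) ^ 2)
            ≤ (A + A / A ^ q * |u y t| ^ q) * (heatKernel (h + σ₀) (y - x) * 1) := by
              gcongr
              exact hsplit _
          _ = A * heatKernel (h + σ₀) (y - x)
              + A / A ^ q * heatKernel (h + σ₀) (y - x) * |u y t| ^ q := by ring
          _ ≤ _ := by gcongr; exact hGle _
      · rw [intervalIntegral.integral_add (Continuous.intervalIntegrable (by fun_prop) _ _)
          (Continuous.intervalIntegrable (by fun_prop) _ _), intervalIntegral.integral_const_mul,
          intervalIntegral.integral_const_mul]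
        have e := intervalIntegral.integral_comp_sub_right (a := x - 1) (b := x + 1)
          (fun z => heatKernel (h + σ₀) z) x
        have e3 : x - 1 - x = -1 := by ring
        have e4 : x + 1 - x = 1 := by ring
        rw [e, e3, e4]
        have i1 := intervalIntegral_heatKernel_le hσ
        have i2 := intervalIntegral_le_of_lintegral_le cq (fun _ => by positivity) hN hLq hle1
        calc _ ≤ A * 1 + A / A ^ q * (1 / √h) * N := by gcongr
          _ = _ := by ring
    rw [← hJT]
    rw [abs_le] at hJt ⊢
    constructor <;> linarith [hJt.1, hJt.2]
  have cT : Continuous fun z => u (x + z) (t + h) * (1 - z ^ 2) ^ 2 :=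
    ((hu.continuous_space (ht.trans_le hth)).comp (by fun_prop)).mul (by fun_prop)
  have hlim := (tendsto_integral_heatKernel_mul cT).abs
  have hc : Tendsto (fun c : ℝ => 1 / c ^ 2) atTop (𝓝 0) :=
    tendsto_const_nhds.div_atTop (tendsto_pow_atTop two_ne_zero)
  have hlim2 : Tendsto (fun c : ℝ => A + A * (N / A ^ q) / √h
      + (8 + 4 * C) * M * (2 * √(h + 1 / c ^ 2) + h)) atTop (𝓝 (A + A * (N / A ^ q) / √h
      + (8 + 4 * C) * M * (2 * √(h + 0) + h))) :=
    tendsto_const_nhds.add (tendsto_const_nhds.mul (((Real.continuous_sqrt.tendsto _).comp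
      (tendsto_const_nhds.add hc)).const_mul 2 |>.add tendsto_const_nhds))
  have hfin := le_of_tendsto_of_tendsto hlim hlim2 (by
    filter_upwards [eventually_gt_atTop 0] with c hc0
    have := hbound (1 / c ^ 2) (by positivity)
    refine le_trans (le_of_eq ?_) this
    congr 1
    have e := intervalIntegral.integral_comp_sub_right (a := x - 1) (b := x + 1)
      (fun z => u (x + z) (t + h) * (1 - z ^ 2) ^ 2 * heatKernel (1 / c ^ 2) z) x
    have e3 : x - 1 - x = -1 := by ring
    have e4 : x + 1 - x = 1 := by ring
    rw [e3, e4] at e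
    rw [← e]
    refine intervalIntegral.integral_congr fun y _ => ?_
    simp only [add_sub_cancel]
    ring)
  simpa using hfin

/-! ### Bounds for the supremum norm -/

theorem exists_pos_mul_sqrt_add_le {K δ : ℝ} (hδ : 0 < δ) :
    ∃ h : ℝ, 0 < h ∧ K * (2 * √h + h) ≤ δ := by
  have hlim : Tendsto (fun h : ℝ => K * (2 * √h + h)) (𝓝[>] 0) (𝓝 (K * (2 * √0 + 0))) :=
    (Continuous.tendsto (by fun_prop) 0).mono_left nhdsWithin_le_nhds
  rw [Real.sqrt_zero, mul_zero, add_zero, mul_zero] at hlim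
  obtain ⟨h, hh, hpos⟩ := ((hlim.eventually (ge_mem_nhds hδ)).and self_mem_nhdsWithin).exists
  exact ⟨h, hpos, hh⟩

/-- An eventual bound for the `L^p` norm makes `u` bounded on all of `ℝ × [0, ∞)`: over a short
time step the heat kernel estimate bounds `u` by a constant plus half its supremum. -/
theorem IsSolution.exists_bound {b : ℝ → ℝ → ℝ} {u₀ : ℝ → ℝ} {u : ℝ → ℝ → ℝ}
    (hb : IsAdvectionField b) (hu : IsSolution b u₀ u) {p N : ℝ} (hp : 1 ≤ p) (hN : 0 ≤ N)
    (hLp : ∀ᶠ t in atTop, ∫⁻ x, ENNReal.ofReal (|u x t| ^ p) ≤ ENNReal.ofReal N) :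
    ∃ M : ℝ, ∀ x t : ℝ, 0 ≤ t → |u x t| ≤ M := by
  obtain ⟨C, hC⟩ := hb.bounded
  obtain ⟨t₁, ht₁⟩ := eventually_atTop.1 (hLp.and (eventually_gt_atTop 0))
  have ht10 : 0 < t₁ := (ht₁ t₁ le_rfl).2
  obtain ⟨h, hh, hhK⟩ := exists_pos_mul_sqrt_add_le (K := 8 + 4 * C) one_half_pos
  obtain ⟨M₀, hM₀⟩ := hu.bounded_strip (t₁ + h) (by linarith)
  set c := 1 + N / √h with hc
  refine ⟨max M₀ (2 * c), fun x t ht => ?_⟩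
  have hT : 0 < t + 1 := by linarith
  obtain ⟨M₁, hM₁⟩ := hu.bounded_strip (t + 1) hT
  -- the supremum is taken over a bounded time interval, where it is known to be finite
  set S := {m : ℝ | ∃ y s : ℝ, 0 ≤ s ∧ s ≤ t + 1 ∧ m = |u y s|} with hS
  have hbdd : BddAbove S := ⟨M₁, by rintro _ ⟨y, s, h1, h2, rfl⟩; exact hM₁ y s h1 h2⟩
  have hne : S.Nonempty := ⟨_, x, t, ht, by linarith, rfl⟩
  have hle : ∀ y s : ℝ, 0 ≤ s → s ≤ t + 1 → |u y s| ≤ sSup S := fun y s h1 h2 =>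
    le_csSup hbdd ⟨y, s, h1, h2, rfl⟩
  have hS0 : 0 ≤ sSup S := (abs_nonneg _).trans (hle x t ht (by linarith))
  have hsup : sSup S ≤ max M₀ (c + sSup S / 2) := by
    refine csSup_le hne ?_
    rintro _ ⟨y, s, h1, h2, rfl⟩
    rcases le_or_gt s (t₁ + h) with hs | hs
    · exact (hM₀ y s h1 hs).trans (le_max_left _ _)
    · refine le_trans ?_ (le_max_right _ _)
      have key := hu.abs_le_of_lintegral_le hb hC (t := s - h) (A := 1) (M := sSup S)
        (by linarith) hh hp hN one_pos (ht₁ (s - h) (by linarith)).1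
        (fun z τ hτ => hle z τ (by linarith [hτ.1]) (by linarith [hτ.2])) y
      rw [sub_add_cancel, Real.one_rpow, div_one, one_mul] at key
      have := mul_le_mul_of_nonneg_left hhK hS0
      linarith
  refine (hle x t ht (by linarith)).trans ?_
  rcases le_max_iff.1 hsup with h1 | h1
  · exact h1.trans (le_max_left _ _)
  · exact le_trans (by linarith) (le_max_right _ _)

/-- Eventual bounds `β` for `B(t)` and `N` for `∫ |u|^p` give the eventual bound `A + δ` for `|u|`
as soon as `2 p C β N ≤ A^p`, where `C` is the cube of the Nash constant. The bounds for
`∫ |u|^{2^j p}` obtained by doubling are `O(2^{-j} A^{2^j p})`; hence the heat kernel estimate,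
over a time step chosen before `j`, leaves only `A`. -/
theorem IsSolution.eventually_abs_le {b : ℝ → ℝ → ℝ} {u₀ : ℝ → ℝ} {u : ℝ → ℝ → ℝ}
    (hb : IsAdvectionField b) (hu : IsSolution b u₀ u) {p N β A δ : ℝ} (hp : 1 ≤ p) (hN : 0 < N)
    (hβ : 0 < β) (hosc : ∀ᶠ t in atTop, halfOsc b t ≤ β)
    (hLp : ∀ᶠ t in atTop, ∫⁻ x, ENNReal.ofReal (|u x t| ^ p) ≤ ENNReal.ofReal N)
    (hA : 0 < A) (hAp : 3 * √3 / (2 * Real.pi) * p * β * N ≤ A ^ p) (hδ : 0 < δ) :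
    ∀ᶠ t in atTop, ∀ x, |u x t| ≤ A + δ := by
  obtain ⟨C, hC⟩ := hb.bounded
  obtain ⟨M, hM⟩ := hu.exists_bound hb hp hN.le hLp
  obtain ⟨h, hh, hhK⟩ := exists_pos_mul_sqrt_add_le (K := (8 + 4 * C) * M) (half_pos hδ)
  set X := p * (3 * √3 / (4 * Real.pi)) * β with hX
  have hX0 : 0 < X := by positivity
  have hXA : 2 * X * N ≤ A ^ p := le_trans (le_of_eq (by rw [hX]; ring)) hAp
  have hsh : 0 < √h := Real.sqrt_pos.2 hh
  have hj : Tendsto (fun j : ℕ => A / X / √h / 2 ^ j) atTop (𝓝 0) :=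
    tendsto_const_nhds.div_atTop (tendsto_pow_atTop_atTop_of_one_lt (by norm_num))
  obtain ⟨j, hj⟩ := (hj.eventually (ge_mem_nhds (half_pos hδ))).exists
  set W := (2 * X * N) ^ 2 ^ j / (2 ^ (j + 1) * X) with hW
  have hW0 : 0 < W := by positivity
  have hq : 1 ≤ 2 ^ j * p := one_le_mul_of_one_le_of_one_le (one_le_pow₀ (by norm_num)) hp
  have hAq : A ^ (2 ^ j * p) = (A ^ p) ^ 2 ^ j := by
    rw [mul_comm, Real.rpow_mul hA.le]
    exact_mod_cast Real.rpow_natCast (A ^ p) (2 ^ j)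
  have hWA : 2 * W / A ^ (2 ^ j * p) ≤ 1 / (X * 2 ^ j) := by
    have hpos : 0 < (A ^ p) ^ 2 ^ j := pow_pos (Real.rpow_pos_of_pos hA p) _
    have h1 : (2 * X * N) ^ 2 ^ j ≤ (A ^ p) ^ 2 ^ j := pow_le_pow_left₀ (by positivity) hXA _
    have e : 2 * W = (2 * X * N) ^ 2 ^ j * (1 / (X * 2 ^ j)) := by
      rw [hW, pow_succ 2 j]; field_simp
    rw [hAq, div_le_iff₀ hpos, e, mul_comm]
    gcongr
  have hev := hu.eventually_lintegral_two_pow_mul_le hb hp hN hβ hosc hLp hX j (2 * W)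
    (by linarith)
  obtain ⟨t₁, ht₁⟩ := eventually_atTop.1 (hev.and (eventually_gt_atTop 0))
  have ht10 : 0 < t₁ := (ht₁ t₁ le_rfl).2
  filter_upwards [eventually_ge_atTop (t₁ + h)] with t ht x
  have key := hu.abs_le_of_lintegral_le hb hC (t := t - h) (by linarith) hh hq
    (by positivity) hA (ht₁ (t - h) (by linarith)).1
    (fun z τ hτ => hM z τ (by linarith [hτ.1])) x
  rw [sub_add_cancel] at key
  have h2 : A * (2 * W / A ^ (2 ^ j * p)) / √h ≤ δ / 2 := by
    refine le_trans ?_ hj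
    calc A * (2 * W / A ^ (2 ^ j * p)) / √h ≤ A * (1 / (X * 2 ^ j)) / √h := by gcongr
      _ = A / X / √h / 2 ^ j := by field_simp
  linarith

/-! ### The infinite product -/

theorem prod_rpow_two_neg_eq {Y : ℝ} (hY : 0 < Y) (k : ℕ) :
    ∏ j ∈ Finset.Icc 1 k, ((2 : ℝ) ^ ((j : ℝ) - 1) * Y) ^ ((2 : ℝ) ^ (-(j : ℝ)))
      = 2 ^ (1 - ((k : ℝ) + 1) * 2 ^ (-(k : ℝ))) * Y ^ (1 - (2 : ℝ) ^ (-(k : ℝ))) := by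
  induction k with
  | zero => simp
  | succ k ih =>
    rw [Finset.prod_Icc_succ_top (by omega), ih]
    have e : (2 : ℝ) ^ (-(k : ℝ)) = 2 * 2 ^ (-((k + 1 : ℕ) : ℝ)) := by
      rw [mul_comm, ← Real.rpow_add_one (by norm_num)]
      congr 1; push_cast; ring
    rw [e]
    set ε := (2 : ℝ) ^ (-((k + 1 : ℕ) : ℝ))
    rw [Real.mul_rpow (by positivity) hY.le, ← Real.rpow_mul (by norm_num), mul_mul_mul_comm,
      ← Real.rpow_add (by norm_num), ← Real.rpow_add hY]
    congr 2 <;> (push_cast; ring)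

theorem tendsto_prod_rpow_two_neg {Y : ℝ} (hY : 0 < Y) :
    Tendsto (fun k : ℕ => ∏ j ∈ Finset.Icc 1 k,
      ((2 : ℝ) ^ ((j : ℝ) - 1) * Y) ^ ((2 : ℝ) ^ (-(j : ℝ)))) atTop (𝓝 (2 * Y)) := by
  have h2 : ∀ k : ℕ, (2 : ℝ) ^ (-(k : ℝ)) = (1 / 2) ^ k := fun k => by
    rw [Real.rpow_neg (by norm_num), Real.rpow_natCast, one_div, inv_pow]
  have h0 : Tendsto (fun k : ℕ => (2 : ℝ) ^ (-(k : ℝ))) atTop (𝓝 0) := by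
    simp only [h2]
    exact tendsto_pow_atTop_nhds_zero_of_lt_one (by norm_num) (by norm_num)
  have h1 : Tendsto (fun k : ℕ => ((k : ℝ) + 1) * (2 : ℝ) ^ (-(k : ℝ))) atTop (𝓝 0) := by
    have h := (tendsto_self_mul_const_pow_of_lt_one (r := 1 / 2) (by norm_num) (by norm_num)).add h0
    rw [add_zero] at h
    refine h.congr fun k => ?_
    rw [h2]; ring
  simp only [prod_rpow_two_neg_eq hY]
  have l1 := (tendsto_const_nhds (x := (2 : ℝ))).rpow (h1.const_sub 1)
    (Or.inl (by norm_num))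
  have l2 := (tendsto_const_nhds (x := Y)).rpow (h0.const_sub 1)
    (Or.inl hY.ne')
  simpa using l1.mul l2

/-! ### The limits at infinity -/

theorem IsAdvectionField.isBoundedUnder_halfOsc {b : ℝ → ℝ → ℝ} (hb : IsAdvectionField b) :
    IsBoundedUnder (· ≤ ·) atTop fun t => halfOsc b t := by
  obtain ⟨C, hC⟩ := hb.bounded
  refine isBoundedUnder_of_eventually_le (a := C) ?_
  filter_upwards [eventually_ge_atTop 0] with t ht
  have h3 : (⨆ x, b x t) ≤ C := ciSup_le fun x => (abs_le.1 (hC x t ht)).2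
  have h4 : -C ≤ ⨅ x, b x t := le_ciInf fun x => (abs_le.1 (hC x t ht)).1
  rw [halfOsc]
  linarith

theorem IsAdvectionField.limHalfOsc_nonneg {b : ℝ → ℝ → ℝ} (hb : IsAdvectionField b) :
    0 ≤ limHalfOsc b := by
  by_contra! hneg
  have h := eventually_lt_of_limsup_lt hneg hb.isBoundedUnder_halfOsc
  obtain ⟨C, hC⟩ := hb.bounded
  obtain ⟨t, ht, ht0⟩ := (h.and (eventually_ge_atTop 0)).exists
  obtain ⟨c, -, hc⟩ := hb.exists_center hC ht0
  exact absurd ((abs_nonneg _).trans (hc 0)) (not_le.2 ht)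

theorem lintegral_ofReal_abs_rpow_eq {p : ℝ} (hp : 0 < p) (f : ℝ → ℝ) :
    ∫⁻ x, ENNReal.ofReal (|f x| ^ p) = eLpNorm f (ENNReal.ofReal p) volume ^ p := by
  rw [eLpNorm_eq_lintegral_rpow_enorm_toReal (by simpa using hp) ENNReal.ofReal_ne_top,
    ENNReal.toReal_ofReal hp.le, ← ENNReal.rpow_mul, one_div, inv_mul_cancel₀ hp.ne',
    ENNReal.rpow_one]
  refine lintegral_congr fun x => ?_
  rw [Real.enorm_eq_ofReal_abs, ENNReal.ofReal_rpow_of_nonneg (abs_nonneg _) hp.le]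

/-- The bound for `limsup ‖u‖_∞` when `limsup ‖u‖_p` is finite. -/
theorem IsSolution.limNorm_top_le {b : ℝ → ℝ → ℝ} {u₀ : ℝ → ℝ} {u : ℝ → ℝ → ℝ}
    (hb : IsAdvectionField b) (hu : IsSolution b u₀ u) {p : ℝ} (hp : 1 ≤ p)
    (hfin : limNorm u (ENNReal.ofReal p) ≠ ⊤) :
    limNorm u ⊤ ≤ ENNReal.ofReal
        ((3 * √3 / (2 * Real.pi) * p) ^ (1 / p) * limHalfOsc b ^ (1 / p))
      * limNorm u (ENNReal.ofReal p) := by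
  have hp0 : 0 < p := by linarith
  have hB0 := hb.limHalfOsc_nonneg
  set L := (limNorm u (ENNReal.ofReal p)).toReal with hL
  have hL0 : 0 ≤ L := ENNReal.toReal_nonneg
  set k := 3 * √3 / (2 * Real.pi) * p with hk
  have hk0 : 0 < k := by positivity
  rw [← ENNReal.ofReal_toReal hfin, ← ENNReal.ofReal_mul (by positivity), ← hL]
  set Q := k ^ (1 / p) * limHalfOsc b ^ (1 / p) * L with hQ
  have hQ0 : 0 ≤ Q := by positivity
  have hQp : Q ^ p = k * limHalfOsc b * L ^ p := by
    rw [hQ, Real.mul_rpow (by positivity) hL0, Real.mul_rpow (by positivity) (by positivity),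
      ← Real.rpow_mul hk0.le, ← Real.rpow_mul hB0, one_div, inv_mul_cancel₀ hp0.ne',
      Real.rpow_one, Real.rpow_one]
  have key : ∀ A : ℝ, Q < A → ∀ δ : ℝ, 0 < δ → limNorm u ⊤ ≤ ENNReal.ofReal (A + δ) := by
    intro A hA δ hδ
    have hA0 : 0 < A := hQ0.trans_lt hA
    have hAp : k * limHalfOsc b * L ^ p < A ^ p := by
      rw [← hQp]; exact Real.rpow_lt_rpow hQ0 hA hp0
    have hcont : Tendsto (fun e : ℝ => k * (limHalfOsc b + e) * (L ^ p + e)) (𝓝[>] 0)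
        (𝓝 (k * (limHalfOsc b + 0) * (L ^ p + 0))) :=
      (Continuous.tendsto (by fun_prop) 0).mono_left nhdsWithin_le_nhds
    rw [add_zero, add_zero] at hcont
    -- room to enlarge both `limsup B` and `L ^ p` by some `e > 0`
    obtain ⟨e, heA, he⟩ := ((hcont.eventually (gt_mem_nhds hAp)).and self_mem_nhdsWithin).exists
    have he : 0 < e := he
    have hLp0 : 0 ≤ L ^ p := by positivity
    have hosc : ∀ᶠ t in atTop, halfOsc b t ≤ limHalfOsc b + e :=
      (eventually_lt_of_limsup_lt (show limHalfOsc b < limHalfOsc b + e by linarith)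
        hb.isBoundedUnder_halfOsc).mono fun t ht => ht.le
    have hlt : limNorm u (ENNReal.ofReal p) < ENNReal.ofReal ((L ^ p + e) ^ (1 / p)) := by
      rw [← ENNReal.ofReal_toReal hfin, ← hL]
      refine (ENNReal.ofReal_lt_ofReal_iff (by positivity)).2 ?_
      rw [one_div, Real.lt_rpow_inv_iff_of_pos hL0 (by positivity) hp0]
      linarith
    have hLp : ∀ᶠ t in atTop, ∫⁻ x, ENNReal.ofReal (|u x t| ^ p) ≤ ENNReal.ofReal (L ^ p + e) := by
      filter_upwards [eventually_lt_of_limsup_lt hlt] with t ht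
      rw [lintegral_ofReal_abs_rpow_eq hp0 fun x => u x t]
      refine (ENNReal.rpow_le_rpow ht.le hp0.le).trans_eq ?_
      rw [ENNReal.ofReal_rpow_of_nonneg (by positivity) hp0.le, one_div,
        Real.rpow_inv_rpow (by positivity) hp0.ne']
    have hev := hu.eventually_abs_le hb hp (by positivity) (by linarith) hosc hLp hA0
      (by rw [← hk]; exact heA.le) hδ
    refine limsup_le_of_le (h := ?_)
    filter_upwards [hev] with t ht
    rw [eLpNorm_exponent_top]
    exact eLpNormEssSup_le_of_ae_bound (Eventually.of_forall fun x => ht x)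
  refine ENNReal.le_of_forall_pos_le_add fun δ hδ _ => ?_
  have hδ' : (0 : ℝ) < δ := by exact_mod_cast hδ
  have h := key (Q + δ / 2) (by linarith) (δ / 2) (by linarith)
  rwa [add_assoc, add_halves, ENNReal.ofReal_add hQ0 δ.coe_nonneg, ENNReal.ofReal_coe_nnreal] at h

theorem mainTheorem1 (b : ℝ → ℝ → ℝ) (hb : IsAdvectionField b)
    (p₀ : ℝ) (hp₀ : 1 ≤ p₀) (u₀ : ℝ → ℝ)
    (hu₀ : MemLp u₀ (ENNReal.ofReal p₀) volume) (hu₀' : MemLp u₀ ⊤ volume)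
    (u : ℝ → ℝ → ℝ) (hu : IsSolution b u₀ u) :
    (∀ p : ℝ, p₀ ≤ p →
      limNorm u ⊤ ≤
        mulTop
          (ENNReal.ofReal
            ((3 * √3 / (2 * Real.pi) * p) ^ (1 / p) * limHalfOsc b ^ (1 / p)))
          (limNorm u (ENNReal.ofReal p)) ∧
      Tendsto
        (fun k : ℕ => (∏ j ∈ Finset.Icc 1 k,
          ((2 : ℝ) ^ ((j : ℝ) - 1) * p * nashConst ^ 3) ^ ((2 : ℝ) ^ (-(j : ℝ)))) ^ (1 / p))
        atTop (𝓝 ((3 * √3 / (2 * Real.pi) * p) ^ (1 / p)))) ∧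
    (p₀ = 1 →
      limNorm u ⊤ ≤
        ENNReal.ofReal (3 * √3 / (2 * Real.pi) * limHalfOsc b) * eLpNorm u₀ 1 volume ∧
      ∃ M : ℝ, ∀ x t : ℝ, 0 ≤ t → |u x t| ≤ M) := by
  refine ⟨fun p hp => ⟨?_, ?_⟩, fun h1 => ?_⟩
  · rw [mulTop]
    split_ifs with h
    · exact le_top
    · exact hu.limNorm_top_le hb (hp₀.trans hp) fun hc => h (Or.inr hc)
  · have hp0 : 0 < p := by linarith
    have hY : 0 < p * nashConst ^ 3 := by rw [nashConst_pow_three]; positivity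
    have h := (tendsto_prod_rpow_two_neg hY).rpow_const (p := 1 / p) (Or.inr (by positivity))
    have e : 2 * (p * nashConst ^ 3) = 3 * √3 / (2 * Real.pi) * p := by
      rw [nashConst_pow_three]; ring
    rw [e] at h
    simpa only [mul_assoc] using h
  · subst h1
    rw [ENNReal.ofReal_one] at hu₀
    have hfin : eLpNorm u₀ 1 volume ≠ ⊤ := hu₀.eLpNorm_ne_top
    have hL1 : ∀ t : ℝ, 0 < t → ∫⁻ x, ENNReal.ofReal (|u x t| ^ (1 : ℝ)) ≤ eLpNorm u₀ 1 volume :=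
      fun t ht => by
        simpa only [Real.rpow_one] using hu.lintegral_abs_le hb hu₀ ht
    have hlim : limNorm u (ENNReal.ofReal 1) ≤ eLpNorm u₀ 1 volume := by
      refine limsup_le_of_le (h := ?_)
      filter_upwards [eventually_gt_atTop 0] with t ht
      have h := hL1 t ht
      rwa [lintegral_ofReal_abs_rpow_eq one_pos fun x => u x t, ENNReal.rpow_one] at h
    refine ⟨?_, ?_⟩
    · have h := hu.limNorm_top_le hb le_rfl (ne_top_of_le_ne_top hfin hlim)
      rw [div_one, Real.rpow_one, Real.rpow_one, mul_one] at h
      exact h.trans (by gcongr)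
    · refine hu.exists_bound hb le_rfl (N := (eLpNorm u₀ 1 volume).toReal)
        ENNReal.toReal_nonneg ?_
      filter_upwards [eventually_gt_atTop 0] with t ht
      rw [ENNReal.ofReal_toReal hfin]
      exact hL1 t ht
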